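/- Let $F$ be a finite field of characteristic $2$, $V$ a $2$-dimensional vector space over $F$, and $(\Omega,V)$ an affine space over $V$ (i.e. $V$ acts on the set $\Omega$ freely and transitively by translations). Fix an origin $o\in\Omega$, and let $GL(V)\rtimes V$ act on $\Omega$ by $(A,v)\cdot(o+u)=o+A(u+v)$, and correspondingly on the set of affine lines $x+D$, where $x\in\Omega$ and $D\subset V$ is a $1$-dimensional subspace. Let $H$ be a complex Hilbert space of dimension $|F|$. A quadrature system is a map $Q$ from the affine lines of $\Omega$ to the linear operators on $H$ such that every $Q(\ell)$ is a rank-one orthogonal projection, $\sum_{\ell\parallel D}Q(\ell)=1$ for every direction $D$, and $\mathrm{tr}(Q(\ell_1)Q(\ell_2))=1/|F|$ whenever $\ell_1,\ell_2$ have different directions. For a subgroup $G\subseteq GL(V)\rtimes V$, $Q$ is $G$-covariant if there is a unitary projective representation $U$ of $G$ on $H$ with $Q(g\cdot\ell)=U(g)Q(\ell)U(g)^*$ for all $g\in G$ and all lines $\ell$. A symplectic form $S$ on $V$ (a nonzero $F$-bilinear map $V\times V\to F$ with $S(v,v)=0$ for all $v$) is associated with $Q$ if there is a function $m:V\times V\to\{z\in\mathbb{C}:|z|=1\}$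 such that $\overline{m(u,v)}\,m(v,u)=(-1)^{\mathrm{Tr}\,S(u,v)}$ for all $u,v$, with $\mathrm{Tr}:F\to\mathbb{Z}_2$ the trace, and such that for every $x\in\Omega$ there is a map $W$ from $V$ to the unitary operators on $H$ with $W(u+v)=m(u,v)W(u)W(v)$, $W(v)Q(\ell)W(v)^*=Q(\ell+v)$, and $W(d)Q(x+D)=Q(x+D)$ for all $u,v\in V$, all lines $\ell$, all directions $D$ and all $d\in D$. An element $A\in SL(V)$ is split if $A=I$ or $A$ has two different eigenvalues $\xi,\xi^{-1}\in F$; it is nonsplit if it has two different eigenvalues $\xi,\xi^{-1}$ in the quadratic extension of $F$ but not in $F$, with $\xi^{-1}=\xi^{|F|}$. It is semisimple if it is split or nonsplit. A torus (split torus, nonsplit torus) is a cyclic subgroup of $SL(V)$ generated by a semisimple (split, nonsplit) element. A maximal split (nonsplit) torus is one that is maximal under inclusion among the split (nonsplit) tori. Theorem. Let $S$ be a symplectic form on $V$. (1) For every subgroup $G_0\subseteq SL(V)$, the following hold: there exists a $(G_0\rtimes V)$-covariant quadrature system on $H$ with associated symplectic form $S$ if and only if $G_0$ is a torus; and there exists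 a $(G_0\rtimes V)$-covariant quadrature system on $H$ (with no condition on the associated form) if and only if $G_0$ is a torus. (2) The subgroups of $SL(V)$ that are maximal under inclusion among the subgroups $G_0\subseteq SL(V)$ admitting a $(G_0\rtimes V)$-covariant quadrature system on $H$ are exactly the maximal split tori and the maximal nonsplit tori if $|F|>2$, and exactly the maximal nonsplit tori if $|F|=2$. (3) The maximal split tori are exactly the split tori of order $|F|-1$, and the maximal nonsplit tori are exactly the nonsplit tori of order $|F|+1$. -/

import Mathlib

open Module

noncomputable section

namespace PhaseSpace

/-! ### The affine phase space and its symmetry group -/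

section Affine

variable (F : Type*) [Field F] (V : Type*) [AddCommGroup V] [Module F V]

/-- The action of `GL(V)` on the additive group `V`, written multiplicatively. -/
def glAut : (V ≃ₗ[F] V) →* MulAut (Multiplicative V) where
  toFun A := AddEquiv.toMultiplicative A.toAddEquiv
  map_one' := rfl
  map_mul' _ _ := rfl

/-- The affine group `GL(V) ⋊ V`, where `V` is the normal factor. -/
abbrev AffineGroup : Type _ := Multiplicative V ⋊[glAut F V] (V ≃ₗ[F] V)

variable {F V}

/-- The subgroup `G₀ ⋊ V` of `GL(V) ⋊ V` determined by a subgroup `G₀` of `SL(V)`. -/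
def semidirectSubgroup (G₀ : Subgroup (SpecialLinearGroup F V)) : Subgroup (AffineGroup F V) :=
  (G₀.map SpecialLinearGroup.toLinearEquiv).comap SemidirectProduct.rightHom

variable {Ω : Type*} [AddTorsor V Ω]

/-- The action of `GL(V) ⋊ V` on `Ω` with origin `o`: linear maps fix `o`, and the normal factor
`V` acts by translations. See `affineAction_apply` for the explicit formula. -/
def affineAction (o : Ω) : AffineGroup F V →* (Ω ≃ᵃ[F] Ω) where
  toFun g := AffineEquiv.mk' (fun x => (g.right (x -ᵥ o) + g.left.toAdd) +ᵥ o) g.right o (by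
    intro x
    simp [add_vadd])
  map_one' := by
    ext x
    change ((x -ᵥ o) + 0) +ᵥ o = x
    simp
  map_mul' g h := by
    ext x
    change ((g * h).right (x -ᵥ o) + (g * h).left.toAdd) +ᵥ o =
      (g.right (((h.right (x -ᵥ o) + h.left.toAdd) +ᵥ o) -ᵥ o) + g.left.toAdd) +ᵥ o
    congr 1
    rw [vadd_vsub, map_add, SemidirectProduct.mul_right, SemidirectProduct.mul_left, toAdd_mul,
      LinearEquiv.mul_apply, add_assoc, add_comm g.left.toAdd]
    rfl

/-- If `(A, v)` denotes the group element "first translate by `v`, then apply `A`", then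
`(A, v) · x = o + A (u + v)`, where `x = o + u`. -/
theorem affineAction_apply (o : Ω) (A : V ≃ₗ[F] V) (v : V) (x : Ω) :
    affineAction o (SemidirectProduct.inr A * SemidirectProduct.inl (Multiplicative.ofAdd v)) x =
      A ((x -ᵥ o) + v) +ᵥ o := by
  rw [map_add]
  change (_ + Multiplicative.toAdd (1 * Multiplicative.ofAdd (A v))) +ᵥ o = _
  rw [one_mul]
  rfl

variable (F V Ω) in
/-- The affine lines of `Ω`, i.e. the sets `x + D` with `D` a one-dimensional subspace of `V`.
(The empty affine subspace has direction `⊥`, so it is excluded.) -/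
abbrev Line : Type _ := {l : AffineSubspace F Ω // finrank F l.direction = 1}

/-- The line `x + D`. -/
def Line.mk' (x : Ω) (D : Submodule F V) (hD : finrank F D = 1) : Line F V Ω :=
  ⟨AffineSubspace.mk' x D, by rw [AffineSubspace.direction_mk']; exact hD⟩

/-- The image of a line under an invertible affine map. -/
def Line.map (e : Ω ≃ᵃ[F] Ω) (l : Line F V Ω) : Line F V Ω :=
  ⟨l.1.map (e : Ω →ᵃ[F] Ω), by
    rw [AffineSubspace.map_direction]
    exact (LinearEquiv.finrank_map_eq e.linear l.1.direction).trans l.2⟩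

/-- There are only finitely many lines, so the sums over parallel lines below are finite sums. -/
theorem finite_line [Finite Ω] : Finite (Line F V Ω) := by
  have : Finite (AffineSubspace F Ω) := Finite.of_injective _ SetLike.coe_injective
  infer_instance

end Affine

/-! ### Quadrature systems -/

section Quadratures

variable {F : Type*} [Field F] {V : Type*} [AddCommGroup V] [Module F V]
  {Ω : Type*} [AddTorsor V Ω]
  {H : Type*} [NormedAddCommGroup H] [InnerProductSpace ℂ H]

/-- A quadrature system for `(Ω, V)` on `H`: a map from the lines of `Ω` to linear operators on `H`
whose values are rank-one orthogonal projections, summing to the identity over each class of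
parallel lines, and with `tr (Q l₁ * Q l₂) = 1 / |F|` for lines with different directions. -/
structure IsQuadratureSystem (Q : Line F V Ω → (H →ₗ[ℂ] H)) : Prop where
  isProjection : ∀ l, (Q l).IsSymmetricProjection
  rank_one : ∀ l, finrank ℂ (LinearMap.range (Q l)) = 1
  sum_parallel : ∀ D : Submodule F V, finrank F D = 1 →
    ∑ᶠ l : {l : Line F V Ω // l.1.direction = D}, Q l.1 = LinearMap.id
  trace_mul : ∀ l₁ l₂ : Line F V Ω, l₁.1.direction ≠ l₂.1.direction →
    LinearMap.trace ℂ H (Q l₁ ∘ₗ Q l₂) = 1 / (Nat.card F : ℂ)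

/-- `U T U*` for a unitary operator `U`. -/
def conj (U : H ≃ₗᵢ[ℂ] H) (T : H →ₗ[ℂ] H) : H →ₗ[ℂ] H :=
  U.toLinearEquiv.toLinearMap ∘ₗ T ∘ₗ U.symm.toLinearEquiv.toLinearMap

/-- `U` is a unitary projective representation of the group `G`. -/
def IsProjectiveRep {G : Type*} [Group G] (U : G → (H ≃ₗᵢ[ℂ] H)) : Prop :=
  ∃ m : G → G → Circle, ∀ g h (x : H), U (g * h) x = (m g h : ℂ) • U g (U h x)

/-- `G`-covariance of `Q` for a subgroup `G` of `GL(V) ⋊ V`, acting on `Ω` with origin `o`. -/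
def IsCovariant (o : Ω) (G : Subgroup (AffineGroup F V)) (Q : Line F V Ω → (H →ₗ[ℂ] H)) : Prop :=
  ∃ U : G → (H ≃ₗᵢ[ℂ] H), IsProjectiveRep U ∧
    ∀ (g : G) (l : Line F V Ω), Q (l.map (affineAction o (g : AffineGroup F V))) = conj (U g) (Q l)

/-- `W` is a projective unitary representation of the translation group `V` with multiplier `m`. -/
def HasMultiplier (W : V → (H ≃ₗᵢ[ℂ] H)) (m : V → V → Circle) : Prop :=
  ∀ (u v : V) (x : H), W (u + v) x = (m u v : ℂ) • W u (W v x)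

/-- `W` implements the translations on `Q`, and `W d` fixes the projection `Q (o + D)` for all
directions `D` and all `d ∈ D`. -/
def IsCenteredAt (Q : Line F V Ω → (H →ₗ[ℂ] H)) (o : Ω) (W : V → (H ≃ₗᵢ[ℂ] H)) : Prop :=
  (∀ (v : V) (l : Line F V Ω), conj (W v) (Q l) = Q (l.map (AffineEquiv.constVAdd F Ω v))) ∧
  (∀ (D : Submodule F V) (hD : finrank F D = 1), ∀ d ∈ D,
    (W d).toLinearEquiv.toLinearMap ∘ₗ Q (Line.mk' o D hD) = Q (Line.mk' o D hD))

/-- `m` is the multiplier associated with `Q`: for every point `o`, it is the multiplier of the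
projective representation of `V` associated with `Q` and centered at `o`. -/
def IsAssociatedMultiplier (Q : Line F V Ω → (H →ₗ[ℂ] H)) (m : V → V → Circle) : Prop :=
  ∀ o : Ω, ∃ W : V → (H ≃ₗᵢ[ℂ] H), HasMultiplier W m ∧ IsCenteredAt Q o W

/-- A symplectic form on `V`. -/
def IsSymplecticForm (S : LinearMap.BilinForm F V) : Prop := S ≠ 0 ∧ S.IsAlt

/-- The absolute trace `F → ZMod 2`. -/
def absTrace [CharP F 2] (a : F) : ZMod 2 :=
  letI := ZMod.algebra F 2
  Algebra.trace (ZMod 2) F a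

/-- In characteristic two, the symplectic form `S` is associated with `Q`:
`conj (m u v) * m v u = (-1) ^ Tr (S u v)` for the multiplier `m` associated with `Q`. -/
def IsAssociatedForm [CharP F 2] (Q : Line F V Ω → (H →ₗ[ℂ] H)) (S : LinearMap.BilinForm F V) :
    Prop :=
  IsSymplecticForm S ∧ ∃ m : V → V → Circle, IsAssociatedMultiplier Q m ∧
    ∀ u v : V, star (m u v : ℂ) * (m v u : ℂ) = (-1) ^ (absTrace (S u v)).val

variable (H) in
/-- There is a `(G₀ ⋊ V)`-covariant quadrature system on `H`. -/
def Admits (o : Ω) (G₀ : Subgroup (SpecialLinearGroup F V)) : Prop :=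
  ∃ Q : Line F V Ω → (H →ₗ[ℂ] H), IsQuadratureSystem Q ∧ IsCovariant o (semidirectSubgroup G₀) Q

variable (H) in
/-- There is a `(G₀ ⋊ V)`-covariant quadrature system on `H` with associated form `S`. -/
def AdmitsWithForm [CharP F 2] (o : Ω) (S : LinearMap.BilinForm F V)
    (G₀ : Subgroup (SpecialLinearGroup F V)) : Prop :=
  ∃ Q : Line F V Ω → (H →ₗ[ℂ] H), IsQuadratureSystem Q ∧
    IsCovariant o (semidirectSubgroup G₀) Q ∧ IsAssociatedForm Q S

end Quadratures

/-! ### Tori in `SL(V)` in characteristic two -/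

section Tori

variable {F : Type*} [Field F] {V : Type*} [AddCommGroup V] [Module F V]
  [FiniteDimensional F V]

/-- `A = 1`, or `A` has two different eigenvalues `ξ, ξ⁻¹` in `F`. -/
def IsSplit (A : SpecialLinearGroup F V) : Prop :=
  A = 1 ∨ ∃ ξ : F, ξ ≠ ξ⁻¹ ∧
    End.HasEigenvalue (A.1 : V →ₗ[F] V) ξ ∧ End.HasEigenvalue (A.1 : V →ₗ[F] V) ξ⁻¹

/-- `A` has two different eigenvalues `ξ, ξ⁻¹` (roots of its characteristic polynomial) in the
quadratic extension of `F` but not in `F`, where `ξ⁻¹` is the conjugate `ξ ^ |F|` of `ξ`.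
The roots of the quadratic characteristic polynomial in the algebraic closure of `F` lie in the
quadratic extension. -/
def IsNonsplit (A : SpecialLinearGroup F V) : Prop :=
  ∃ ξ : AlgebraicClosure F, ξ ∉ Set.range (algebraMap F (AlgebraicClosure F)) ∧ ξ ≠ ξ⁻¹ ∧
    ξ⁻¹ = ξ ^ Nat.card F ∧
    Polynomial.aeval ξ (LinearMap.charpoly (A.1 : V →ₗ[F] V)) = 0 ∧
    Polynomial.aeval ξ⁻¹ (LinearMap.charpoly (A.1 : V →ₗ[F] V)) = 0

/-- Semisimple elements of `SL(V)`. -/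
def IsSemisimpleElement (A : SpecialLinearGroup F V) : Prop := IsSplit A ∨ IsNonsplit A

/-- A cyclic subgroup generated by a semisimple element. -/
def IsTorus (T : Subgroup (SpecialLinearGroup F V)) : Prop :=
  ∃ A, IsSemisimpleElement A ∧ T = Subgroup.zpowers A

/-- A cyclic subgroup generated by a split element. -/
def IsSplitTorus (T : Subgroup (SpecialLinearGroup F V)) : Prop :=
  ∃ A, IsSplit A ∧ T = Subgroup.zpowers A

/-- A cyclic subgroup generated by a nonsplit element. -/
def IsNonsplitTorus (T : Subgroup (SpecialLinearGroup F V)) : Prop :=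
  ∃ A, IsNonsplit A ∧ T = Subgroup.zpowers A

end Tori

end PhaseSpace

end

/-! The existence of a covariant quadrature system is equivalent, for a subgroup `G₀` of `SL(V)`, to
`G₀` having odd order, and so is being a torus.

*Tori.* An element of `SL(V)` other than `1` is semisimple if and only if its trace `t` is nonzero,
since its characteristic polynomial is `X² + t X + 1`; trace zero means being an involution. The
order of a split (nonsplit) element divides `|F| - 1` (`|F| + 1`), which is odd. Conversely let `G₀`
have odd order. Averaging an endomorphism of trace one over `G₀` gives an endomorphism `y` of trace
one that commutes with `G₀`. Scalars have trace zero in characteristic two, so `y` is not scalar,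
`G₀` lies in `F[y]`, and an eigenvalue of `y` embeds `G₀` into the multiplicative group of a field:
`G₀` is cyclic (`isTorus_of_odd_card`). Split tori lie in the diagonal group of a basis, and a
nonsplit torus lies in the subgroup of order `|F| + 1` of the multiplicative group of the field with
`|F|²` elements which it generates in `End V`; this determines the maximal tori.

*Sufficiency.* A Weyl system `W` is a projective representation of `V` with commutation relations
given by the symplectic form `S`, normalised to be a representation on each line through the
origin. Fourier transforms of `W` along these lines are the projections of a quadrature system
(`IsWeylSystem.isQuadratureSystem`). Elements `A` of `SL(V)` are implemented by unitary operators
`P`, but only up to signs: `P W(v) P* = ± W(A v)`. If `A` has odd order `N`, the signs can be removed: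
`P` can be chosen with `P ^ N` scalar, and the product of the `N` signs of the powers of `A` is the
required change of the phases of `W` (`IsWeylSystem.exists_covariant`).

*Necessity.* A covariant quadrature system determines a projective representation `W` of `V`, with
phases fixed by the lines through the origin and therefore preserved exactly by the symmetries
(`IsCovariant.exists_centered`). If `G₀` had even order, it would contain a transvection `e ↦ e`,
`f ↦ f + e`. Invariance under it makes `W (c f)` commute with `W (c e)` for every `c`, which forces
`W f` to commute with `W (c e)` for every `c` (`commute_of_transvection`). Then `W f` would be the
identity, but it permutes the lines in the direction of `e` without fixed lines. -/

noncomputable section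

namespace PhaseSpace

/-! ### Semisimple elements of `SL(V)` -/

section ToriTheory

open Polynomial

variable {F : Type*} [Field F] {V : Type*} [AddCommGroup V] [Module F V]

theorem SL_coe_pow (A : SpecialLinearGroup F V) (n : ℕ) :
    ((A ^ n).1 : V →ₗ[F] V) = (A.1 : V →ₗ[F] V) ^ n := by
  induction n with
  | zero => rfl
  | succ n ih => rw [pow_succ, pow_succ, ← ih]; rfl

theorem SL_ext_linearMap {A B : SpecialLinearGroup F V}
    (h : (A.1 : V →ₗ[F] V) = (B.1 : V →ₗ[F] V)) : A = B :=
  Subtype.ext (LinearEquiv.toLinearMap_injective h)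

variable [FiniteDimensional F V]

theorem charpoly_eq_of_finrank_two (hV : finrank F V = 2) (f : V →ₗ[F] V) :
    f.charpoly = X ^ 2 - C (LinearMap.trace F V f) * X + C (LinearMap.det f) := by
  let b := finBasisOfFinrankEq F V hV
  rw [← LinearMap.charpoly_toMatrix f b, Matrix.charpoly_fin_two,
    LinearMap.trace_eq_matrix_trace F b, LinearMap.det_toMatrix]

theorem charpoly_specialLinear (hV : finrank F V = 2) (A : SpecialLinearGroup F V) :
    (A.1 : V →ₗ[F] V).charpoly = X ^ 2 - C (LinearMap.trace F V A.1) * X + 1 := by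
  rw [charpoly_eq_of_finrank_two hV, SpecialLinearGroup.det_eq_one, map_one]

/-- If the characteristic polynomial of `A` has the distinct roots `ξ` and `ξ⁻¹`, possibly in an
extension field, then it divides `X ^ N - 1` as soon as `ξ ^ N = 1`. -/
theorem pow_eq_one_of_root {L : Type*} [Field L] [Algebra F L] (hV : finrank F V = 2)
    {A : SpecialLinearGroup F V} {ξ : L} (hξ : ξ ≠ ξ⁻¹)
    (hroot : aeval ξ (A.1 : V →ₗ[F] V).charpoly = 0) {N : ℕ} (hN : ξ ^ N = 1) : A ^ N = 1 := by
  have h0 : ξ ≠ 0 := by rintro rfl; simp at hξ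
  have hdvd : (A.1 : V →ₗ[F] V).charpoly ∣ X ^ N - 1 := by
    rw [← map_dvd_map' (algebraMap F L)]
    have hfac : (A.1 : V →ₗ[F] V).charpoly.map (algebraMap F L) = (X - C ξ) * (X - C ξ⁻¹) := by
      rw [charpoly_specialLinear hV] at hroot ⊢
      set t := LinearMap.trace F V A.1
      have ht : algebraMap F L t = ξ + ξ⁻¹ := by
        simp only [map_add, map_sub, map_mul, map_pow, aeval_X, aeval_C, map_one] at hroot
        field_simp
        linear_combination -hroot
      have h1 : (1 : L[X]) = C ξ * C ξ⁻¹ := by rw [← C_mul, mul_inv_cancel₀ h0, C_1]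
      simp only [Polynomial.map_add, Polynomial.map_sub, Polynomial.map_mul, Polynomial.map_pow,
        map_X, map_C, Polynomial.map_one, ht, C_add]
      linear_combination h1
    rw [hfac]
    refine IsCoprime.mul_dvd ?_ ?_ ?_
    · exact isCoprime_X_sub_C_of_isUnit_sub (sub_ne_zero.2 hξ).isUnit
    · rw [dvd_iff_isRoot]
      simp [hN]
    · rw [dvd_iff_isRoot]
      simp [hN]
  obtain ⟨r, hr⟩ := hdvd
  have := congrArg (aeval (A.1 : V →ₗ[F] V)) hr
  rw [map_mul, LinearMap.aeval_self_charpoly, zero_mul, map_sub, map_pow, aeval_X, map_one,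
    sub_eq_zero, ← SL_coe_pow] at this
  exact SL_ext_linearMap this

theorem IsSplit.pow_card_sub_one [Finite F] (hV : finrank F V = 2) {A : SpecialLinearGroup F V}
    (hA : IsSplit A) : A ^ (Nat.card F - 1) = 1 := by
  rcases hA with rfl | ⟨ξ, hξ, h1, -⟩
  · exact one_pow _
  · have := Fintype.ofFinite F
    refine pow_eq_one_of_root (L := F) hV hξ ?_ ?_
    · rw [End.hasEigenvalue_iff_isRoot_charpoly] at h1
      rw [coe_aeval_eq_eval]
      exact h1
    · rw [Nat.card_eq_fintype_card]
      refine FiniteField.pow_card_sub_one_eq_one ξ ?_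
      rintro rfl
      simp at hξ

theorem IsNonsplit.pow_card_add_one (hV : finrank F V = 2) {A : SpecialLinearGroup F V}
    (hA : IsNonsplit A) : A ^ (Nat.card F + 1) = 1 := by
  obtain ⟨ξ, -, hξ, h1, h2, -⟩ := hA
  refine pow_eq_one_of_root hV hξ h2 ?_
  have h0 : ξ ≠ 0 := by rintro rfl; simp at hξ
  rw [pow_succ, ← h1, inv_mul_cancel₀ h0]

/-- The elements fixed by `x ↦ x ^ |F|` lie in `F`, as `X ^ |F| - X` splits over `F`. -/
theorem mem_range_algebraMap_of_pow_card [Finite F] {L : Type*} [Field L] [Algebra F L] {ξ : L}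
    (h : ξ ^ Nat.card F = ξ) : ξ ∈ Set.range (algebraMap F L) := by
  have := Fintype.ofFinite F
  have hs : (X ^ Nat.card F - X : F[X]).Splits := by
    rw [Nat.card_eq_fintype_card]
    rw [splits_iff_card_roots, FiniteField.roots_X_pow_card_sub_X,
      FiniteField.X_pow_card_sub_X_natDegree_eq F Fintype.one_lt_card]
    rfl
  have hne : (X ^ Nat.card F - X : F[X]) ≠ 0 :=
    FiniteField.X_pow_card_sub_X_ne_zero F Finite.one_lt_card
  exact hs.mem_range_of_isRoot (i := algebraMap F L) (x := ξ) hne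
    (by simp only [IsRoot.def, eval_map, eval₂_sub, eval₂_X_pow, eval₂_X, h, sub_self])

/-- In characteristic two an element of odd order is semisimple: if it had trace zero, it would be
an involution. -/
theorem isSemisimpleElement_of_odd_pow [Finite F] [CharP F 2] (hV : finrank F V = 2)
    {A : SpecialLinearGroup F V} {N : ℕ} (hN : Odd N) (hA : A ^ N = 1) :
    IsSemisimpleElement A := by
  by_cases hA1 : A = 1
  · exact Or.inl (Or.inl hA1)
  set t := LinearMap.trace F V A.1 with ht
  have hcp := charpoly_specialLinear hV A
  rw [← ht] at hcp
  have h2 : (2 : F) = 0 := CharTwo.two_eq_zero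
  have ht0 : t ≠ 0 := by
    intro h0
    have hch := LinearMap.aeval_self_charpoly (A.1 : V →ₗ[F] V)
    rw [hcp, h0] at hch
    simp only [map_zero, zero_mul, sub_zero, map_add, map_pow, aeval_X, map_one] at hch
    have hsq : A ^ 2 = 1 := by
      refine SL_ext_linearMap ?_
      rw [SL_coe_pow, eq_neg_of_add_eq_zero_left hch]
      ext v
      have : (v : V) + v = 0 := by rw [← two_smul F v, h2, zero_smul]
      exact neg_eq_of_add_eq_zero_left this
    obtain ⟨k, rfl⟩ := hN
    rw [pow_succ, pow_mul, hsq, one_pow, one_mul] at hA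
    exact hA1 hA
  obtain ⟨ξ, hξ⟩ := IsAlgClosed.exists_aeval_eq_zero (AlgebraicClosure F)
    (A.1 : V →ₗ[F] V).charpoly (by
      rw [degree_eq_natDegree (LinearMap.charpoly_monic _).ne_zero,
        LinearMap.charpoly_natDegree, hV]
      norm_num)
  have hchar : CharP (AlgebraicClosure F) 2 := charP_of_injective_algebraMap
    (algebraMap F (AlgebraicClosure F)).injective 2
  have h2' : (2 : AlgebraicClosure F) = 0 := CharTwo.two_eq_zero
  have haev (x : AlgebraicClosure F) : aeval x (A.1 : V →ₗ[F] V).charpoly =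
      x ^ 2 - algebraMap F _ t * x + 1 := by
    rw [hcp]; simp
  have hξ0 : ξ ≠ 0 := by
    rintro rfl
    rw [haev] at hξ
    simp at hξ
  have htr : algebraMap F (AlgebraicClosure F) t = ξ + ξ⁻¹ := by
    rw [haev] at hξ
    field_simp
    linear_combination -hξ
  have hne : ξ ≠ ξ⁻¹ := by
    intro h
    rw [← h, ← two_mul, h2', zero_mul] at htr
    exact ht0 ((map_eq_zero _).1 htr)
  have hroot' : aeval ξ⁻¹ (A.1 : V →ₗ[F] V).charpoly = 0 := by
    rw [haev, htr]
    field_simp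
    ring
  by_cases hmem : ξ ∈ Set.range (algebraMap F (AlgebraicClosure F))
  · obtain ⟨x, rfl⟩ := hmem
    rw [← map_inv₀] at hne hroot'
    refine Or.inl (Or.inr ⟨x, fun h => hne (by rw [← h]), ?_, ?_⟩)
    all_goals
      rw [End.hasEigenvalue_iff_isRoot_charpoly, IsRoot.def, ← coe_aeval_eq_eval]
      apply (algebraMap F (AlgebraicClosure F)).injective
      rw [← aeval_algebraMap_apply, map_zero]
      assumption
  · refine Or.inr ⟨ξ, hmem, hne, ?_, hξ, hroot'⟩
    have := Fintype.ofFinite F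
    have hpow : aeval (ξ ^ Nat.card F) (A.1 : V →ₗ[F] V).charpoly = 0 := by
      have h := aeval_algHom_apply (FiniteField.frobeniusAlgHom F (AlgebraicClosure F)) ξ
        (A.1 : V →ₗ[F] V).charpoly
      rw [hξ, map_zero] at h
      rwa [Nat.card_eq_fintype_card]
    rw [haev, htr] at hpow
    have : (ξ ^ Nat.card F - ξ) * (ξ ^ Nat.card F - ξ⁻¹) = 0 := by
      have h1 : ξ * ξ⁻¹ = 1 := mul_inv_cancel₀ hξ0
      linear_combination hpow + h1
    rcases mul_eq_zero.1 this with h | h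
    · exact absurd (mem_range_algebraMap_of_pow_card (sub_eq_zero.1 h)) hmem
    · exact (sub_eq_zero.1 h).symm

end ToriTheory

/-! ### Subgroups of odd order are tori -/

section ToriTheory

open Polynomial

variable {F : Type*} [Field F] {V : Type*} [AddCommGroup V] [Module F V] [FiniteDimensional F V]

theorem even_card_of_charTwo [Finite F] [CharP F 2] : Even (Nat.card F) := by
  have := Fintype.ofFinite F
  rw [even_iff_two_dvd, Nat.card_eq_fintype_card, ← CharP.cast_eq_zero_iff F 2]
  exact FiniteField.cast_card_eq_zero F

theorem IsSplitTorus.card_dvd [Finite F] (hV : finrank F V = 2)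
    {T : Subgroup (SpecialLinearGroup F V)} (hT : IsSplitTorus T) :
    Nat.card T ∣ Nat.card F - 1 := by
  obtain ⟨A, hA, rfl⟩ := hT
  rw [Nat.card_zpowers]
  exact orderOf_dvd_of_pow_eq_one (hA.pow_card_sub_one hV)

theorem IsNonsplitTorus.card_dvd (hV : finrank F V = 2)
    {T : Subgroup (SpecialLinearGroup F V)} (hT : IsNonsplitTorus T) :
    Nat.card T ∣ Nat.card F + 1 := by
  obtain ⟨A, hA, rfl⟩ := hT
  rw [Nat.card_zpowers]
  exact orderOf_dvd_of_pow_eq_one (hA.pow_card_add_one hV)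

theorem isTorus_iff_split_or_nonsplit {T : Subgroup (SpecialLinearGroup F V)} :
    IsTorus T ↔ IsSplitTorus T ∨ IsNonsplitTorus T := by
  constructor
  · rintro ⟨A, h | h, rfl⟩
    exacts [Or.inl ⟨A, h, rfl⟩, Or.inr ⟨A, h, rfl⟩]
  · rintro (⟨A, h, rfl⟩ | ⟨A, h, rfl⟩)
    exacts [⟨A, Or.inl h, rfl⟩, ⟨A, Or.inr h, rfl⟩]

theorem IsTorus.odd_card [Finite F] [CharP F 2] (hV : finrank F V = 2)
    {T : Subgroup (SpecialLinearGroup F V)} (hT : IsTorus T) : Odd (Nat.card T) := by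
  have hq := even_card_of_charTwo (F := F)
  have h1 : 1 < Nat.card F := Finite.one_lt_card
  rcases isTorus_iff_split_or_nonsplit.1 hT with h | h
  · exact Odd.of_dvd_nat (Nat.Even.sub_odd h1.le hq odd_one) (h.card_dvd hV)
  · exact Odd.of_dvd_nat hq.add_one (h.card_dvd hV)

theorem exists_trace_eq_one (hV : finrank F V = 2) : ∃ f : End F V, LinearMap.trace F V f = 1 := by
  let b := finBasisOfFinrankEq F V hV
  refine ⟨Matrix.toLin b b (Matrix.single 0 0 1), ?_⟩
  rw [LinearMap.trace_eq_matrix_trace F b, LinearMap.toMatrix_toLin]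
  simp

/-- Endomorphisms of a plane commuting with a nonscalar one `y` are of the form `a + b y`, since
some vector `v` is not an eigenvector of `y` and they are determined by their value at `v`. -/
theorem exists_eq_add_smul_of_commute (hV : finrank F V = 2) {y : End F V}
    (hy : ∀ c : F, y ≠ c • 1) {f : End F V} (hf : Commute f y) :
    ∃ a b : F, f = a • 1 + b • y := by
  obtain ⟨v, hv⟩ : ∃ v : V, LinearIndependent F ![v, y v] := by
    by_contra! h
    obtain ⟨c, hc⟩ := LinearMap.exists_eq_smul_id_of_forall_notLinearIndependent h
    exact hy c hc
  have hspan : Submodule.span F (Set.range ![v, y v]) = ⊤ :=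
    hv.span_eq_top_of_card_eq_finrank (by simp [hV])
  have hfv : f v ∈ Submodule.span F (Set.range ![v, y v]) := hspan ▸ Submodule.mem_top
  rw [Matrix.range_cons, Matrix.range_cons, Matrix.range_empty, Set.union_empty,
    Set.singleton_union, Submodule.mem_span_pair] at hfv
  obtain ⟨a, b, hab⟩ := hfv
  refine ⟨a, b, LinearMap.ext_on_range hspan fun i => ?_⟩
  have h2 : f (y v) = y (f v) := LinearMap.congr_fun hf v
  fin_cases i
  · simpa using hab.symm
  · simp [h2, ← hab]

/-- A subgroup of odd order of `SL(V)` is a torus. Averaging an endomorphism of trace one over the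
group yields an endomorphism `y` of trace one, hence not scalar in characteristic two, which
commutes with the group. So the group lies in `F[y]`, and an eigenvalue of `y` turns it
into a finite group of nonzero elements of a field. -/
theorem isTorus_of_odd_card [Finite F] [CharP F 2] (hV : finrank F V = 2)
    {G : Subgroup (SpecialLinearGroup F V)} (hG : Odd (Nat.card G)) : IsTorus G := by
  have : Finite G := Nat.finite_of_card_ne_zero hG.pos.ne'
  have := Fintype.ofFinite G
  have h2 : (2 : F) = 0 := CharTwo.two_eq_zero
  let ρ : SpecialLinearGroup F V →* End F V :=
    (LinearEquiv.automorphismGroup.toLinearMapMonoidHom).comp SpecialLinearGroup.toLinearEquiv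
  have hρ (A) : ρ A = (A.1 : V →ₗ[F] V) := rfl
  obtain ⟨x, hx⟩ := exists_trace_eq_one (F := F) (V := V) hV
  let y : End F V := ∑ g : G, ρ g * x * ρ (g : SpecialLinearGroup F V)⁻¹
  have hytr : LinearMap.trace F V y = 1 := by
    have h1 (g : SpecialLinearGroup F V) : LinearMap.trace F V (ρ g * x * ρ g⁻¹) = 1 := by
      rw [LinearMap.trace_mul_comm, ← mul_assoc, ← map_mul, inv_mul_cancel, map_one, one_mul, hx]
    rw [map_sum, Finset.sum_congr rfl fun (g : G) _ => h1 g, Finset.sum_const, Finset.card_univ,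
      ← Nat.card_eq_fintype_card, nsmul_one]
    obtain ⟨k, hk⟩ := hG
    rw [hk]; push_cast; rw [h2]; ring
  have hy : ∀ c : F, y ≠ c • 1 := by
    intro c hc
    rw [hc, map_smul, LinearMap.trace_one, hV, smul_eq_mul, Nat.cast_ofNat, h2, mul_zero] at hytr
    exact zero_ne_one hytr
  have hcomm (g : G) : Commute (ρ g) y := by
    have : ρ g * y * ρ (g : SpecialLinearGroup F V)⁻¹ = y := by
      simp only [y, Finset.mul_sum, Finset.sum_mul]
      refine Fintype.sum_equiv (Equiv.mulLeft g) _ _ fun k => ?_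
      simp [mul_assoc]
    calc ρ g * y = ρ g * y * (ρ (g : SpecialLinearGroup F V)⁻¹ * ρ g) := by
          rw [← map_mul, inv_mul_cancel, map_one, mul_one]
      _ = y * ρ g := by rw [← mul_assoc, this]
  choose a b hab using fun g => exists_eq_add_smul_of_commute hV hy (hcomm g)
  -- evaluation of elements of `F[y]` at a root of the characteristic polynomial of `y`
  obtain ⟨ξ, hξ⟩ := IsAlgClosed.exists_aeval_eq_zero (AlgebraicClosure F) y.charpoly (by
      rw [degree_eq_natDegree (LinearMap.charpoly_monic _).ne_zero,
        LinearMap.charpoly_natDegree, hV]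
      norm_num)
  have hy2 := LinearMap.aeval_self_charpoly y
  rw [charpoly_eq_of_finrank_two hV, hytr] at hy2 hξ
  set D := LinearMap.det y
  simp only [map_one, one_mul, map_add, map_sub, map_pow, aeval_X, aeval_C,
    Algebra.algebraMap_eq_smul_one] at hy2 hξ
  have hy2' : y * y = y - D • 1 := by
    rw [← sub_eq_zero, ← hy2]; noncomm_ring
  have hfree : ∀ c d : F, c • (1 : End F V) + d • y = 0 → c = 0 ∧ d = 0 := by
    intro c d h
    have hd : d = 0 := by
      by_contra hd
      refine hy (-(d⁻¹ * c)) ?_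
      have := congrArg (d⁻¹ • ·) h
      simp only [smul_add, smul_smul, inv_mul_cancel₀ hd, one_smul, smul_zero] at this
      rw [neg_smul, eq_neg_of_add_eq_zero_right this]
    rw [hd, zero_smul, add_zero] at h
    have : Nontrivial V := nontrivial_of_finrank_pos (R := F) (by omega)
    exact ⟨(smul_eq_zero.1 h).resolve_right one_ne_zero, hd⟩
  have huniq : ∀ c d c' d' : F, c • (1 : End F V) + d • y = c' • 1 + d' • y → c = c' ∧ d = d' := by
    intro c d c' d' h
    have := hfree (c - c') (d - d') (by
      rw [sub_smul, sub_smul]; rw [← sub_eq_zero] at h; rw [← h]; abel)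
    exact ⟨sub_eq_zero.1 this.1, sub_eq_zero.1 this.2⟩
  let K := AlgebraicClosure F
  let ev : G →* K :=
    { toFun := fun g => algebraMap F K (a g) + algebraMap F K (b g) * ξ
      map_one' := by
        have := huniq (a 1) (b 1) 1 0 (by rw [← hab]; simp)
        simp [this.1, this.2]
      map_mul' := fun g h => by
        have := huniq (a (g * h)) (b (g * h)) (a g * a h - b g * b h * D)
          (a g * b h + b g * a h + b g * b h) (by
            rw [← hab, Subgroup.coe_mul, map_mul, hab, hab]
            simp only [mul_add, add_mul, smul_mul_smul_comm, one_mul, mul_one, hy2', smul_sub,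
              smul_smul, sub_smul, add_smul]
            abel)
        rw [this.1, this.2]
        simp only [map_sub, map_add, map_mul]
        have hD : ξ ^ 2 = ξ - algebraMap F K D := by
          rw [Algebra.algebraMap_eq_smul_one]
          linear_combination hξ
        linear_combination (-(algebraMap F K (b g) * algebraMap F K (b h))) * hD }
  have hev : Function.Injective ev := by
    rw [injective_iff_map_eq_one]
    intro g hg
    have hg' : algebraMap F K (a g) + algebraMap F K (b g) * ξ = 1 := hg
    have hgt : LinearMap.trace F V ((g : SpecialLinearGroup F V).1 : V →ₗ[F] V) = b g := by
      rw [← hρ, hab, map_add, map_smul, map_smul, LinearMap.trace_one, hytr, hV, smul_eq_mul,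
        Nat.cast_ofNat, h2, mul_zero, zero_add, smul_eq_mul, mul_one]
    have hch := LinearMap.aeval_self_charpoly ((g : SpecialLinearGroup F V).1 : V →ₗ[F] V)
    rw [charpoly_specialLinear hV, hgt, ← hρ, hab] at hch
    simp only [map_one, map_add, map_sub, map_mul, map_pow, aeval_X, aeval_C,
      Algebra.algebraMap_eq_smul_one] at hch
    have hcoef := (hfree (a g * a g - b g * b g * D - b g * a g + 1) (2 * a g * b g) (by
      rw [← hch, pow_two]
      simp only [mul_add, add_mul, smul_mul_smul_comm, one_mul, mul_one, hy2', smul_sub,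
              smul_smul, sub_smul, add_smul, two_mul, mul_comm (a g) (b g)]
      module)).1
    have hcoef' := congrArg (algebraMap F K) hcoef
    have h2K : (2 : K) = 0 := by rw [← map_ofNat (algebraMap F K), h2, map_zero]
    have hD : ξ ^ 2 = ξ - algebraMap F K D := by
      rw [Algebra.algebraMap_eq_smul_one]
      linear_combination hξ
    simp only [map_sub, map_add, map_mul, map_one, map_zero] at hcoef'
    -- the image `1` of `g` is a root of its characteristic polynomial, so its trace vanishes
    have hb : algebraMap F K (b g) = 0 := by
      generalize algebraMap F K (a g) = α at *
      generalize algebraMap F K (b g) = β at *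
      generalize algebraMap F K D = δ at *
      linear_combination (1 - α * β * ξ) * h2K - hcoef' - β ^ 2 * hD + (α + β * ξ + 1 - β) * hg'
    have hb' : b g = 0 := (map_eq_zero _).1 hb
    rw [hb', map_zero, zero_mul, add_zero, ← map_one (algebraMap F K)] at hg'
    have ha' : a g = 1 := (algebraMap F K).injective hg'
    refine Subtype.ext (SL_ext_linearMap ?_)
    rw [← hρ, hab, ha', hb', one_smul, zero_smul, add_zero]
    rfl
  have hcyc : IsCyclic G := isCyclic_of_injective_ringHom ev hev
  obtain ⟨g, hg⟩ := hcyc.exists_generator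
  refine ⟨g, isSemisimpleElement_of_odd_pow hV hG ?_, ?_⟩
  · rw [← Subgroup.coe_pow, pow_card_eq_one', Subgroup.coe_one]
  · refine le_antisymm (fun h hh => ?_) (by simp)
    obtain ⟨k, hk⟩ := Subgroup.mem_zpowers_iff.1 (hg ⟨h, hh⟩)
    exact Subgroup.mem_zpowers_iff.2 ⟨k, by simpa using congrArg Subtype.val hk⟩

end ToriTheory

/-! ### Maximal tori -/

section ToriTheory

open Polynomial

variable {F : Type*} [Field F] {V : Type*} [AddCommGroup V] [Module F V]

/-- The diagonal element of `SL(V)` with entries `η` and `η⁻¹` in a given basis. -/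
def diagSL (b : Basis (Fin 2) F V) : Fˣ →* SpecialLinearGroup F V where
  toFun η := ⟨b.equiv (b.unitsSMul ![η, η⁻¹]) (Equiv.refl _), by
    rw [← Units.val_inj, LinearEquiv.coe_det, ← LinearMap.det_toMatrix b, Matrix.det_fin_two]
    simp [LinearMap.toMatrix_apply, Basis.unitsSMul_apply, Units.smul_def]⟩
  map_one' := by
    refine SL_ext_linearMap (b.ext fun i => ?_)
    fin_cases i <;> simp [Basis.unitsSMul_apply]
  map_mul' x y := by
    refine SL_ext_linearMap (b.ext fun i => ?_)
    fin_cases i <;> simp [Basis.unitsSMul_apply, Units.smul_def, mul_comm, smul_smul]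

theorem diagSL_apply_zero (b : Basis (Fin 2) F V) (η : Fˣ) :
    (diagSL b η).1 (b 0) = (η : F) • b 0 := by
  simp [diagSL, Basis.unitsSMul_apply, Units.smul_def]

theorem diagSL_apply_one (b : Basis (Fin 2) F V) (η : Fˣ) :
    (diagSL b η).1 (b 1) = ((η : F)⁻¹) • b 1 := by
  simp [diagSL, Basis.unitsSMul_apply, Units.smul_def]

theorem diagSL_injective (b : Basis (Fin 2) F V) : Function.Injective (diagSL b) := by
  intro x y h
  have := diagSL_apply_zero b x
  rw [h, diagSL_apply_zero] at this
  exact Units.ext (smul_left_injective F (b.ne_zero 0) this).symm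

theorem isSplit_diagSL [CharP F 2] (b : Basis (Fin 2) F V) (η : Fˣ) : IsSplit (diagSL b η) := by
  by_cases h : η = 1
  · left; rw [h, map_one]
  · refine Or.inr ⟨η, fun h' => h ?_, ?_, ?_⟩
    · have h1 : (η : F) * η = 1 := by nth_rw 2 [h']; simp
      have : ((η : F) + 1) * (η + 1) = 0 := by
        linear_combination h1 + (η + 1 : F) * (CharTwo.two_eq_zero (R := F))
      have := (mul_self_eq_zero.1 this)
      exact Units.ext (by rw [Units.val_one, ← CharTwo.add_eq_zero]; exact this)
    · exact End.hasEigenvalue_of_hasEigenvector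
        (End.hasEigenvector_iff.2 ⟨End.mem_eigenspace_iff.2 (diagSL_apply_zero b η), b.ne_zero 0⟩)
    · exact End.hasEigenvalue_of_hasEigenvector
        (End.hasEigenvector_iff.2 ⟨End.mem_eigenspace_iff.2 (diagSL_apply_one b η), b.ne_zero 1⟩)

variable [FiniteDimensional F V]

theorem IsSplit.exists_eq_diagSL (hV : finrank F V = 2) {A : SpecialLinearGroup F V}
    (hA : IsSplit A) : ∃ b : Basis (Fin 2) F V, ∃ η : Fˣ, A = diagSL b η := by
  rcases hA with rfl | ⟨ξ, hξ, h1, h2⟩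
  · exact ⟨finBasisOfFinrankEq F V hV, 1, (map_one _).symm⟩
  · obtain ⟨v, hv⟩ := h1.exists_hasEigenvector
    obtain ⟨w, hw⟩ := h2.exists_hasEigenvector
    have hli : LinearIndependent F ![v, w] :=
      End.eigenvectors_linearIndependent' (A.1 : End F V) ![ξ, ξ⁻¹] (by
        intro i j; fin_cases i <;> fin_cases j <;> simp [hξ, hξ.symm]) _ (by
        intro i; fin_cases i <;> simp [hv, hw])
    have h0 : ξ ≠ 0 := by rintro rfl; simp at hξ
    let b := basisOfLinearIndependentOfCardEqFinrank hli (by simp [hV])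
    have hb0 : b 0 = v := by simp [b]
    have hb1 : b 1 = w := by simp [b]
    refine ⟨b, Units.mk0 ξ h0, SL_ext_linearMap (b.ext fun i => ?_)⟩
    fin_cases i
    · refine Eq.trans ?_ (diagSL_apply_zero b _).symm
      simpa [hb0] using hv.apply_eq_smul
    · refine Eq.trans ?_ (diagSL_apply_one b _).symm
      simpa [hb1] using hw.apply_eq_smul

theorem IsSplitTorus.exists_le [Finite F] [CharP F 2] (hV : finrank F V = 2)
    {T : Subgroup (SpecialLinearGroup F V)} (hT : IsSplitTorus T) :
    ∃ T', IsSplitTorus T' ∧ T ≤ T' ∧ Nat.card T' = Nat.card F - 1 := by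
  obtain ⟨A, hA, rfl⟩ := hT
  obtain ⟨b, η, rfl⟩ := hA.exists_eq_diagSL hV
  obtain ⟨g, hg⟩ := IsCyclic.exists_generator (α := Fˣ)
  refine ⟨_, ⟨_, isSplit_diagSL b g, rfl⟩, ?_, ?_⟩
  · rw [Subgroup.zpowers_le, ← MonoidHom.map_zpowers]
    exact ⟨η, hg η, rfl⟩
  · rw [Nat.card_zpowers, orderOf_injective _ (diagSL_injective b),
      orderOf_eq_card_of_forall_mem_zpowers hg]
    have := Fintype.ofFinite F
    classical
    rw [Nat.card_eq_fintype_card, Nat.card_eq_fintype_card, Fintype.card_units]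

/-- The elements of order `|F| + 1` are powers of a generator of the multiplicative group of the
field with `|F| ^ 2` elements, which `A` generates in `End V`. -/
theorem IsNonsplitTorus.exists_le [Finite F] [CharP F 2] (hV : finrank F V = 2)
    {T : Subgroup (SpecialLinearGroup F V)} (hT : IsNonsplitTorus T) :
    ∃ T', IsNonsplitTorus T' ∧ T ≤ T' ∧ Nat.card T' = Nat.card F + 1 := by
  obtain ⟨A, hA, rfl⟩ := hT
  have hApow := hA.pow_card_add_one hV
  obtain ⟨ξ, hξF, hξ, -, h1, h2⟩ := hA
  set f : End F V := (A.1 : V →ₗ[F] V)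
  have hmon := LinearMap.charpoly_monic f
  have hdeg : f.charpoly.natDegree = 2 := by rw [LinearMap.charpoly_natDegree, hV]
  have hirr : Irreducible f.charpoly := by
    refine irreducible_of_degree_le_three_of_not_isRoot (by simp [hdeg]) fun x hx => hξF ?_
    rw [charpoly_specialLinear hV] at hx h1
    simp only [IsRoot.def, eval_add, eval_sub, eval_mul, eval_pow, eval_X, eval_C, eval_one] at hx
    simp only [map_add, map_sub, map_mul, map_pow, aeval_X, aeval_C, map_one] at h1
    have hx' := congrArg (algebraMap F (AlgebraicClosure F)) hx
    set t := LinearMap.trace F V A.1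
    simp only [map_add, map_sub, map_mul, map_pow, map_one, map_zero] at hx'
    have : (ξ - algebraMap F _ x) * (ξ - algebraMap F _ (t - x)) = 0 := by
      rw [map_sub]
      linear_combination h1 - hx'
    rcases mul_eq_zero.1 this with h | h
    exacts [⟨_, (sub_eq_zero.1 h).symm⟩, ⟨_, (sub_eq_zero.1 h).symm⟩]
  have : Fact (Irreducible f.charpoly) := ⟨hirr⟩
  let K := AdjoinRoot f.charpoly
  let φ : K →ₐ[F] End F V := Ideal.Quotient.liftₐ (Ideal.span {f.charpoly}) (aeval f) fun p hp => by
    obtain ⟨r, rfl⟩ := Ideal.mem_span_singleton.1 hp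
    rw [map_mul, LinearMap.aeval_self_charpoly, zero_mul]
  have hφroot : φ (AdjoinRoot.root _) = f := aeval_X f
  have : Nontrivial V := nontrivial_of_finrank_pos (R := F) (by omega)
  have hφ : Function.Injective φ := φ.toRingHom.injective
  let pb := AdjoinRoot.powerBasis' hmon
  have : FiniteDimensional F K := pb.finite
  have : Finite K := Module.finite_of_finite F
  have hK : finrank F K = 2 := by rw [pb.finrank]; exact hdeg
  have hcardK : Nat.card K = Nat.card F ^ 2 := by
    rw [Module.natCard_eq_pow_finrank (K := F), hK]
  have hq : 1 < Nat.card F := Finite.one_lt_card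
  have hcardU : Nat.card Kˣ = (Nat.card F - 1) * (Nat.card F + 1) := by
    rw [Nat.card_units, hcardK, mul_comm]
    exact Nat.sq_sub_sq (Nat.card F) 1
  obtain ⟨g, hg⟩ := IsCyclic.exists_generator (α := Kˣ)
  have hgo : orderOf g = (Nat.card F - 1) * (Nat.card F + 1) := by
    rw [← hcardU, orderOf_eq_card_of_forall_mem_zpowers hg]
  -- the powers of `g ^ (|F| - 1)` have determinant one, as `det` takes values in `Fˣ`
  let h := g ^ (Nat.card F - 1)
  have hho : orderOf h = Nat.card F + 1 := by
    rw [orderOf_pow_of_dvd (by omega) (hgo ▸ dvd_mul_right _ _), hgo,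
      Nat.mul_div_cancel_left _ (by omega)]
  let Φ : Kˣ →* (V ≃ₗ[F] V) :=
    (LinearMap.GeneralLinearGroup.generalLinearEquiv F V).toMonoidHom.comp
      (Units.map (φ : K →* End F V))
  have hΦ (k : Kˣ) : (Φ k : V →ₗ[F] V) = φ k := rfl
  have hΦinj : Function.Injective Φ := fun x y hxy => Units.ext (hφ (by
    rw [← hΦ, ← hΦ, hxy]))
  have hdet : LinearEquiv.det (Φ h) = 1 := by
    rw [map_pow, map_pow]
    have := Fintype.ofFinite F
    classical
    have : Nat.card F - 1 = Fintype.card Fˣ := by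
      rw [Fintype.card_units, Nat.card_eq_fintype_card]
    rw [this, pow_card_eq_one]
  let B : SpecialLinearGroup F V := ⟨Φ h, hdet⟩
  have hBo : orderOf B = Nat.card F + 1 := by
    rw [← hho, ← orderOf_injective Φ hΦinj]
    exact orderOf_injective (SpecialLinearGroup.toLinearEquiv (R := F) (V := V))
      Subtype.val_injective B |>.symm
  refine ⟨_, ⟨B, ?_, rfl⟩, ?_, ?_⟩
  · refine (isSemisimpleElement_of_odd_pow hV (N := Nat.card F + 1) ?_ ?_).resolve_left ?_
    · exact even_card_of_charTwo.add_one
    · rw [← hBo, pow_orderOf_eq_one]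
    · intro hs
      have := orderOf_dvd_of_pow_eq_one (hs.pow_card_sub_one hV)
      rw [hBo] at this
      have := Nat.le_of_dvd (by omega) this
      omega
  · rw [Subgroup.zpowers_le]
    have hr0 : AdjoinRoot.root f.charpoly ≠ 0 := by
      intro h0
      rw [h0, map_zero] at hφroot
      obtain ⟨v, hv⟩ := exists_ne (0 : V)
      exact hv (A.1.injective (by rw [map_zero]; exact (LinearMap.congr_fun hφroot v).symm))
    let r : Kˣ := Units.mk0 (AdjoinRoot.root f.charpoly) hr0
    have hΦr : Φ r = A.1 := LinearEquiv.toLinearMap_injective hφroot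
    have hrpow : r ^ (Nat.card F + 1) = 1 := by
      apply hΦinj
      rw [map_pow, hΦr, map_one]
      exact congrArg Subtype.val hApow
    obtain ⟨j, hj⟩ := Subgroup.mem_zpowers_iff.1 (hg r)
    obtain ⟨k, rfl⟩ : ((Nat.card F - 1 : ℕ) : ℤ) ∣ j := by
      rw [← hj, ← zpow_natCast, ← zpow_mul, ← orderOf_dvd_iff_zpow_eq_one, hgo,
        Nat.cast_mul] at hrpow
      exact Int.dvd_of_mul_dvd_mul_right (by positivity) hrpow
    refine Subgroup.mem_zpowers_iff.2 ⟨k, Subtype.ext ?_⟩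
    rw [SpecialLinearGroup.coe_zpow, ← hΦr, ← hj]
    simp only [B, h]
    rw [← map_zpow, zpow_mul, zpow_natCast]
  · rw [Nat.card_zpowers, hBo]

/-- Over the field with two elements, the element `!![0, 1; 1, 1]` of order three is nonsplit. -/
theorem exists_isNonsplitTorus_of_card_two [Finite F] [CharP F 2] (hV : finrank F V = 2)
    (hF : Nat.card F = 2) : ∃ T : Subgroup (SpecialLinearGroup F V), IsNonsplitTorus T := by
  let b := finBasisOfFinrankEq F V hV
  let e := Matrix.SpecialLinearGroup.toLin_equiv b
  obtain ⟨M, hM⟩ : ∃ M : Matrix.SpecialLinearGroup (Fin 2) F, M.1 = !![0, 1; 1, 1] :=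
    ⟨⟨!![0, 1; 1, 1], by simp [Matrix.det_fin_two, CharTwo.neg_eq]⟩, rfl⟩
  have h2 : (2 : F) = 0 := CharTwo.two_eq_zero
  have hM2 : M ^ 2 ≠ 1 := by
    intro h
    have := congrArg (fun N : Matrix.SpecialLinearGroup (Fin 2) F => N.1 0 1) h
    simp [hM, pow_two, Matrix.SpecialLinearGroup.coe_mul] at this
  have hM3 : M ^ 3 = 1 := by
    ext i j
    fin_cases i <;> fin_cases j <;> simp [hM, pow_succ, CharTwo.add_self_eq_zero]
  have hM1 : M ≠ 1 := by rintro h; rw [h] at hM2; simp at hM2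
  refine ⟨_, e M, ?_, rfl⟩
  refine (isSemisimpleElement_of_odd_pow hV (N := 3) (by decide) ?_).resolve_left fun hs => ?_
  · rw [← map_pow, hM3, map_one]
  · have := hs.pow_card_sub_one hV
    rw [hF, pow_one, EmbeddingLike.map_eq_one_iff] at this
    exact hM1 this

theorem maximal_isSplitTorus_iff [Finite F] [CharP F 2] (hV : finrank F V = 2)
    (T : Subgroup (SpecialLinearGroup F V)) :
    Maximal IsSplitTorus T ↔ IsSplitTorus T ∧ Nat.card T = Nat.card F - 1 := by
  have hq : 1 < Nat.card F := Finite.one_lt_card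
  constructor
  · intro hT
    obtain ⟨T', h1, h2, h3⟩ := hT.prop.exists_le hV
    rw [hT.eq_of_le h1 h2]
    exact ⟨h1, h3⟩
  · rintro ⟨h1, h2⟩
    refine ⟨h1, fun T' h3 h4 => ?_⟩
    have hd := Nat.le_of_dvd (by omega) (h3.card_dvd hV)
    have : Finite T' := Nat.finite_of_card_ne_zero fun h => by
      have := h3.card_dvd hV
      rw [h, zero_dvd_iff] at this
      omega
    exact (Subgroup.eq_of_le_of_card_ge h4 (by omega)).ge

theorem maximal_isNonsplitTorus_iff [Finite F] [CharP F 2] (hV : finrank F V = 2)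
    (T : Subgroup (SpecialLinearGroup F V)) :
    Maximal IsNonsplitTorus T ↔ IsNonsplitTorus T ∧ Nat.card T = Nat.card F + 1 := by
  have hq : 1 < Nat.card F := Finite.one_lt_card
  constructor
  · intro hT
    obtain ⟨T', h1, h2, h3⟩ := hT.prop.exists_le hV
    rw [hT.eq_of_le h1 h2]
    exact ⟨h1, h3⟩
  · rintro ⟨h1, h2⟩
    refine ⟨h1, fun T' h3 h4 => ?_⟩
    have hd := Nat.le_of_dvd (by omega) (h3.card_dvd hV)
    have : Finite T' := Nat.finite_of_card_ne_zero fun h => by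
      have := h3.card_dvd hV
      rw [h, zero_dvd_iff] at this
      omega
    exact (Subgroup.eq_of_le_of_card_ge h4 (by omega)).ge

/-- A maximal split torus is a maximal torus unless `|F| = 2`, because `|F| - 1` divides `|F| + 1`
only for `|F| = 2`, the field having even cardinality. -/
theorem maximal_isTorus_iff [Finite F] [CharP F 2] (hV : finrank F V = 2)
    (T : Subgroup (SpecialLinearGroup F V)) :
    Maximal IsTorus T ↔
      (Nat.card F ≠ 2 ∧ Maximal IsSplitTorus T) ∨ Maximal IsNonsplitTorus T := by
  have hq : 1 < Nat.card F := Finite.one_lt_card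
  constructor
  · intro hT
    rcases isTorus_iff_split_or_nonsplit.1 hT.prop with h | h
    · refine Or.inl ⟨fun hF => ?_, h, fun T' h1 h2 =>
        hT.le_of_ge (isTorus_iff_split_or_nonsplit.2 (Or.inl h1)) h2⟩
      have h1 := h.card_dvd hV
      rw [hF, Nat.dvd_one, Subgroup.card_eq_one] at h1
      subst h1
      obtain ⟨T', h'⟩ := exists_isNonsplitTorus_of_card_two (V := V) hV hF
      obtain ⟨T'', h1, -, h2⟩ := h'.exists_le hV
      have := hT.eq_of_le (isTorus_iff_split_or_nonsplit.2 (Or.inr h1)) bot_le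
      rw [← this, Subgroup.card_bot] at h2
      omega
    · exact Or.inr ⟨h, fun T' h1 h2 =>
        hT.le_of_ge (isTorus_iff_split_or_nonsplit.2 (Or.inr h1)) h2⟩
  · rintro (⟨hF, hT⟩ | hT)
    · refine ⟨isTorus_iff_split_or_nonsplit.2 (Or.inl hT.prop), fun T' h1 h2 => ?_⟩
      rcases isTorus_iff_split_or_nonsplit.1 h1 with h1 | h1
      · exact hT.le_of_ge h1 h2
      · have h3 := ((maximal_isSplitTorus_iff hV T).1 hT).2
        have h4 := (Subgroup.card_dvd_of_le h2).trans (h1.card_dvd hV)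
        rw [h3] at h4
        have h5 : Nat.card F - 1 ∣ 2 := by
          have := Nat.dvd_sub h4 (dvd_refl (Nat.card F - 1))
          rwa [show Nat.card F + 1 - (Nat.card F - 1) = 2 by omega] at this
        have h6 := Nat.le_of_dvd two_pos h5
        obtain ⟨k, hk⟩ := even_card_of_charTwo (F := F)
        omega
    · refine ⟨isTorus_iff_split_or_nonsplit.2 (Or.inr hT.prop), fun T' h1 h2 => ?_⟩
      rcases isTorus_iff_split_or_nonsplit.1 h1 with h1 | h1
      · have h3 := ((maximal_isNonsplitTorus_iff hV T).1 hT).2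
        have h4 := Nat.le_of_dvd (by omega) ((Subgroup.card_dvd_of_le h2).trans (h1.card_dvd hV))
        omega
      · exact hT.le_of_ge h1 h2

end ToriTheory

/-! ### Signs, phases and unitary operators -/

section Sign

variable {F : Type*} [Field F] [CharP F 2]

/-- The additive character `a ↦ (-1) ^ Tr a` of `F`. -/
def sgn (a : F) : Circle := (-1) ^ (absTrace a).val

theorem absTrace_add (a b : F) : absTrace (a + b) = absTrace a + absTrace b := by
  let _ := ZMod.algebra F 2
  exact map_add (Algebra.trace (ZMod 2) F) a b

theorem sgn_add (a b : F) : sgn (a + b) = sgn a * sgn b := by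
  rw [sgn, sgn, sgn, absTrace_add, ← pow_add, ZMod.val_add]
  generalize (absTrace a).val + (absTrace b).val = n
  conv_rhs => rw [← Nat.mod_add_div n 2, pow_add, pow_mul, neg_one_sq, one_pow, mul_one]

theorem sgn_zero : sgn (0 : F) = 1 := by
  have h := sgn_add (0 : F) 0
  rwa [add_zero, left_eq_mul] at h

theorem sgn_eq_one_or (a : F) : sgn a = 1 ∨ sgn a = -1 := neg_one_pow_eq_or _ _

theorem sgn_mul_self (a : F) : sgn a * sgn a = 1 := by
  rcases sgn_eq_one_or a with h | h <;> simp [h]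

theorem sgn_inv (a : F) : (sgn a)⁻¹ = sgn a := inv_eq_of_mul_eq_one_left (sgn_mul_self a)

theorem exists_sgn_mul_eq_neg_one [Finite F] {a : F} (ha : a ≠ 0) : ∃ b, sgn (b * a) = -1 := by
  let _ := ZMod.algebra F 2
  have h : Algebra.trace (ZMod 2) F ≠ 0 := Algebra.trace_ne_zero _ _
  obtain ⟨c, hc⟩ : ∃ c, Algebra.trace (ZMod 2) F c ≠ 0 := by
    by_contra! h'
    exact h (LinearMap.ext h')
  refine ⟨c * a⁻¹, ?_⟩
  rw [mul_assoc, inv_mul_cancel₀ ha, mul_one, sgn]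
  have : absTrace c = 1 := (Fin.eq_one_of_ne_zero _ hc : _)
  rw [this]
  simp [ZMod.val_one]

theorem sum_sgn_mul [Fintype F] [DecidableEq F] (a : F) :
    ∑ t : F, (sgn (t * a) : ℂ) = if a = 0 then (Fintype.card F : ℂ) else 0 := by
  split_ifs with h
  · simp [h, sgn_zero]
  · obtain ⟨b, hb⟩ := exists_sgn_mul_eq_neg_one h
    have h1 : ∑ t : F, (sgn (t * a) : ℂ) = ∑ t : F, (sgn ((t + b) * a) : ℂ) :=
      (Fintype.sum_equiv (Equiv.addRight b) _ _ fun t => rfl).symm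
    simp only [add_mul, sgn_add, hb, mul_neg, mul_one, Circle.coe_neg, Finset.sum_neg_distrib] at h1
    linear_combination (1 / 2 : ℂ) * h1

end Sign

section Operators

variable {H : Type*} [NormedAddCommGroup H] [InnerProductSpace ℂ H]

/-- Multiplication by a complex number of modulus one, as a unitary operator. -/
def phase : Circle →* (H ≃ₗᵢ[ℂ] H) where
  toFun c :=
    { LinearEquiv.smulOfNeZero ℂ H (c : ℂ) c.coe_ne_zero with
      norm_map' := fun x => by
        change ‖(c : ℂ) • x‖ = ‖x‖
        rw [norm_smul, Circle.norm_coe, one_mul] }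
  map_one' := by ext x; exact one_smul ℂ x
  map_mul' c d := by ext x; exact mul_smul (c : ℂ) (d : ℂ) x

@[simp]
theorem phase_apply (c : Circle) (x : H) : phase c x = (c : ℂ) • x := rfl

theorem unitary_mul_apply (U U' : H ≃ₗᵢ[ℂ] H) (x : H) : (U * U') x = U (U' x) := rfl

theorem phase_mul_comm (c : Circle) (U : H ≃ₗᵢ[ℂ] H) : U * phase c = phase c * U := by
  ext x
  simp

theorem phase_mul_left_comm (c : Circle) (U U' : H ≃ₗᵢ[ℂ] H) :
    U * (phase c * U') = phase c * (U * U') := by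
  rw [← mul_assoc, phase_mul_comm, mul_assoc]

theorem phase_mul_mul (c d : Circle) (U : H ≃ₗᵢ[ℂ] H) :
    phase c * (phase d * U) = phase (c * d) * U := by
  rw [map_mul, mul_assoc]

theorem phase_injective [Nontrivial H] : Function.Injective (phase : Circle → (H ≃ₗᵢ[ℂ] H)) := by
  intro c d h
  obtain ⟨x, hx⟩ := exists_ne (0 : H)
  have : (c : ℂ) • x = (d : ℂ) • x := congrArg (fun U : H ≃ₗᵢ[ℂ] H => U x) h
  exact Circle.ext (smul_left_injective ℂ hx this)

/-- A unitary operator as an element of the algebra of linear operators. -/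
def op : (H ≃ₗᵢ[ℂ] H) →* End ℂ H where
  toFun U := U.toLinearEquiv.toLinearMap
  map_one' := rfl
  map_mul' _ _ := rfl

@[simp]
theorem op_apply (U : H ≃ₗᵢ[ℂ] H) (x : H) : op U x = U x := rfl

theorem op_phase (c : Circle) : op (phase c : H ≃ₗᵢ[ℂ] H) = (c : ℂ) • (1 : End ℂ H) := rfl

theorem op_phase_mul (c : Circle) (U : H ≃ₗᵢ[ℂ] H) : op (phase c * U) = (c : ℂ) • op U := rfl

theorem conj_eq (U : H ≃ₗᵢ[ℂ] H) (T : End ℂ H) : conj U T = op U * T * op U⁻¹ := rfl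

theorem conj_mul (U U' : H ≃ₗᵢ[ℂ] H) (T : End ℂ H) : conj (U * U') T = conj U (conj U' T) := rfl

theorem conj_phase_mul (c : Circle) (U : H ≃ₗᵢ[ℂ] H) (T : End ℂ H) :
    conj (phase c * U) T = conj U T := by
  rw [conj_eq, conj_eq, mul_inv_rev, ← map_inv, phase_mul_comm, op_phase_mul, op_phase_mul,
    smul_mul_assoc, smul_mul_assoc, mul_smul_comm, smul_smul, ← Circle.coe_mul, mul_inv_cancel,
    Circle.coe_one, one_smul]

end Operators

/-! ### Symplectic forms, Weyl systems and projections attached to lines -/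

section Symplectic

variable {F : Type*} [Field F] {V : Type*} [AddCommGroup V] [Module F V]

theorem IsSymplecticForm.comm [CharP F 2] {S : LinearMap.BilinForm F V} (hS : IsSymplecticForm S)
    (u v : V) : S u v = S v u := by
  rw [← hS.2.neg_eq, CharTwo.neg_eq]

theorem alt_apply_eq {S : LinearMap.BilinForm F V} (hS : S.IsAlt) (b : Basis (Fin 2) F V)
    (u v : V) :
    S u v = (b.repr u 0 * b.repr v 1 - b.repr u 1 * b.repr v 0) * S (b 0) (b 1) := by
  conv_lhs => rw [← b.sum_repr u, ← b.sum_repr v]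
  have h0 : S (b 0) (b 0) = 0 := hS _
  have h1 : S (b 1) (b 1) = 0 := hS _
  have h2 : S (b 1) (b 0) = - S (b 0) (b 1) := (hS.neg_eq _ _).symm
  simp only [Fin.sum_univ_two, map_add, map_smul, LinearMap.add_apply, LinearMap.smul_apply,
    smul_eq_mul, h0, h1, h2]
  ring

theorem IsSymplecticForm.basis_ne_zero {S : LinearMap.BilinForm F V} (hS : IsSymplecticForm S)
    (b : Basis (Fin 2) F V) : S (b 0) (b 1) ≠ 0 := by
  intro h
  refine hS.1 (LinearMap.ext₂ fun u v => ?_)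
  rw [alt_apply_eq hS.2 b, h, mul_zero]
  rfl

theorem alt_map_eq [FiniteDimensional F V] (hV : finrank F V = 2)
    {S : LinearMap.BilinForm F V} (hS : S.IsAlt)
    (A : SpecialLinearGroup F V) (u v : V) : S (A.1 u) (A.1 v) = S u v := by
  let b := finBasisOfFinrankEq F V hV
  have hdet := SpecialLinearGroup.det_eq_one A
  rw [← LinearMap.det_toMatrix b, Matrix.det_fin_two] at hdet
  simp only [LinearMap.toMatrix_apply] at hdet
  let S' : LinearMap.BilinForm F V := S.compl₁₂ (A.1 : V →ₗ[F] V) (A.1 : V →ₗ[F] V)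
  have hS' : S'.IsAlt := fun x => hS _
  have h1 : S (A.1 u) (A.1 v) = S' u v := rfl
  have h2 : S' (b 0) (b 1) = S (A.1 (b 0)) (A.1 (b 1)) := rfl
  rw [h1, alt_apply_eq hS' b, h2, alt_apply_eq hS b (A.1 (b 0)), alt_apply_eq hS b u]
  linear_combination ((b.repr u) 0 * (b.repr v) 1 - (b.repr u) 1 * (b.repr v) 0) *
    S (b 0) (b 1) * hdet

theorem exists_basis_of_ne_zero (hV : finrank F V = 2) {v : V} (hv : v ≠ 0) :
    ∃ b : Basis (Fin 2) F V, b 0 = v := by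
  obtain ⟨w, hw⟩ : ∃ w : V, w ∉ Submodule.span F {v} := by
    by_contra! h
    have h1 : Submodule.span F {v} = ⊤ := eq_top_iff.2 fun w _ => h w
    have := finrank_span_singleton (K := F) hv
    rw [h1, finrank_top, hV] at this
    omega
  have hli : LinearIndependent F ![v, w] := by
    rw [LinearIndependent.pair_iff' hv]
    intro a ha
    exact hw (Submodule.mem_span_singleton.2 ⟨a, ha⟩)
  exact ⟨basisOfLinearIndependentOfCardEqFinrank hli (by simp [hV]), by simp⟩

theorem IsSymplecticForm.exists_ne_zero (hV : finrank F V = 2) {S : LinearMap.BilinForm F V}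
    (hS : IsSymplecticForm S) {v : V} (hv : v ≠ 0) : ∃ u, S v u ≠ 0 := by
  obtain ⟨b, rfl⟩ := exists_basis_of_ne_zero hV hv
  exact ⟨b 1, hS.basis_ne_zero b⟩

end Symplectic

section Weyl

variable {F : Type*} [Field F] [CharP F 2] {V : Type*} [AddCommGroup V] [Module F V]
  {H : Type*} [NormedAddCommGroup H] [InnerProductSpace ℂ H]

/-- A Weyl system for the symplectic form `S`: a projective unitary representation `W` of `V` with
commutation relations given by `S`, whose phases are chosen so that `W` is a representation on
every one-dimensional subspace. -/
structure IsWeylSystem (S : LinearMap.BilinForm F V) (W : V → (H ≃ₗᵢ[ℂ] H)) : Prop where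
  add : ∀ u v, ∃ c : Circle, W (u + v) = phase c * (W u * W v)
  comm : ∀ u v, W u * W v = phase (sgn (S u v)) * (W v * W u)
  line : ∀ (v : V) (a b : F), W ((a + b) • v) = W (a • v) * W (b • v)

theorem conj_sgn (a : F) : (starRingEnd ℂ) (sgn a : ℂ) = sgn a := by
  rw [← Circle.coe_inv_eq_conj, sgn_inv]

namespace IsWeylSystem

variable {S : LinearMap.BilinForm F V} {W : V → (H ≃ₗᵢ[ℂ] H)}

theorem zero (hW : IsWeylSystem S W) : W 0 = 1 := by
  have := hW.line 0 0 0
  simpa using this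

theorem mul_self (hW : IsWeylSystem S W) (v : V) : W v * W v = 1 := by
  have := hW.line v 1 1
  rw [CharTwo.add_self_eq_zero, zero_smul, one_smul, hW.zero] at this
  exact this.symm

theorem inner_eq (hW : IsWeylSystem S W) (v : V) (x y : H) :
    inner ℂ (W v x) y = inner ℂ x (W v y) := by
  have h : W v (W v x) = x := congrArg (fun U : H ≃ₗᵢ[ℂ] H => U x) (hW.mul_self v)
  rw [← LinearIsometryEquiv.inner_map_map (W v) (W v x) y, h]

theorem conj_op (hW : IsWeylSystem S W) (u v : V) :
    conj (W u) (op (W v)) = (sgn (S u v) : ℂ) • op (W v) := by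
  rw [conj_eq, ← map_mul, ← map_mul, hW.comm u v, mul_assoc, mul_assoc, mul_inv_cancel, mul_one,
    op_phase_mul]

/-- Conjugation by a suitable `W u` changes the sign of `W v`. -/
theorem trace_op_eq_zero [Finite F] [FiniteDimensional F V] (hV : finrank F V = 2)
    (hS : IsSymplecticForm S)
    (hW : IsWeylSystem S W) {v : V} (hv : v ≠ 0) : LinearMap.trace ℂ H (op (W v)) = 0 := by
  obtain ⟨u, hu⟩ := hS.exists_ne_zero hV hv
  rw [hS.comm] at hu
  obtain ⟨c, hc⟩ := exists_sgn_mul_eq_neg_one hu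
  have h := congrArg (LinearMap.trace ℂ H) (hW.conj_op (c • u) v)
  rw [map_smul S c u, LinearMap.smul_apply, smul_eq_mul, hc, conj_eq, LinearMap.trace_mul_comm,
    ← mul_assoc, ← map_mul, inv_mul_cancel, map_one, one_mul, map_smul] at h
  have h' : LinearMap.trace ℂ H (op (W v)) = -LinearMap.trace ℂ H (op (W v)) := by
    simpa using h
  linear_combination (1 / 2 : ℂ) * h'

end IsWeylSystem

variable [Fintype F]

/-- The operator `|F|⁻¹ ∑ₜ (-1) ^ Tr (t S(y, v)) W(t v)`, which is the projection onto the joint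
eigenspace of the `W (t v)` with eigenvalues `(-1) ^ Tr (t S(y, v))`. -/
def lineProj (S : LinearMap.BilinForm F V) (W : V → (H ≃ₗᵢ[ℂ] H)) (y v : V) : End ℂ H :=
  (Fintype.card F : ℂ)⁻¹ • ∑ t : F, (sgn (t * S y v) : ℂ) • op (W (t • v))

section

variable {S : LinearMap.BilinForm F V} {W : V → (H ≃ₗᵢ[ℂ] H)}

theorem lineProj_smul_right (y v : V) {c : F} (hc : c ≠ 0) :
    lineProj S W y (c • v) = lineProj S W y v := by
  unfold lineProj
  congr 1
  refine Fintype.sum_equiv (Equiv.mulRight₀ c hc) _ _ fun t => ?_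
  simp [smul_smul, mul_assoc]

theorem lineProj_add_smul (hS : IsSymplecticForm S) (y v : V) (c : F) :
    lineProj S W (y + c • v) v = lineProj S W y v := by
  have h : S v v = 0 := hS.2 v
  simp [lineProj, h]

theorem IsWeylSystem.op_mul_lineProj (hW : IsWeylSystem S W) (y v : V) (c : F) :
    op (W (c • v)) * lineProj S W y v = (sgn (c * S y v) : ℂ) • lineProj S W y v := by
  unfold lineProj
  rw [mul_smul_comm, smul_comm]
  congr 1
  rw [Finset.mul_sum, Finset.smul_sum]
  refine Fintype.sum_equiv (Equiv.addLeft c) _ _ fun t => ?_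
  rw [Equiv.coe_addLeft, add_mul, sgn_add, hW.line, map_mul, smul_smul, mul_smul_comm,
    Circle.coe_mul, ← mul_assoc, ← Circle.coe_mul, sgn_mul_self, Circle.coe_one, one_mul]

theorem IsWeylSystem.lineProj_mul_self (hW : IsWeylSystem S W) (y v : V) :
    lineProj S W y v * lineProj S W y v = lineProj S W y v := by
  conv_lhs => enter [1]; unfold lineProj
  rw [smul_mul_assoc, Finset.sum_mul]
  simp_rw [smul_mul_assoc, hW.op_mul_lineProj, smul_smul, ← Circle.coe_mul, sgn_mul_self,
    Circle.coe_one, one_smul]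
  rw [Finset.sum_const, Finset.card_univ, ← Nat.cast_smul_eq_nsmul ℂ, smul_smul,
    inv_mul_cancel₀ (Nat.cast_ne_zero.2 Fintype.card_ne_zero), one_smul]

theorem IsWeylSystem.isSymmetric_lineProj (hW : IsWeylSystem S W) (y v : V) :
    (lineProj S W y v).IsSymmetric := by
  intro x z
  simp only [lineProj, LinearMap.smul_apply, LinearMap.sum_apply, inner_smul_left, inner_smul_right,
    sum_inner, inner_sum, op_apply, hW.inner_eq, conj_sgn, map_inv₀, map_natCast]

theorem IsWeylSystem.trace_lineProj [FiniteDimensional F V] (hV : finrank F V = 2)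
    (hS : IsSymplecticForm S) (hH : finrank ℂ H = Fintype.card F)
    (hW : IsWeylSystem S W) (y : V) {v : V} (hv : v ≠ 0) :
    LinearMap.trace ℂ H (lineProj S W y v) = 1 := by
  have : FiniteDimensional ℂ H := FiniteDimensional.of_finrank_pos (hH ▸ Fintype.card_pos)
  rw [lineProj, map_smul, map_sum, Finset.sum_eq_single 0]
  · rw [zero_mul, sgn_zero, zero_smul, hW.zero, map_one, Circle.coe_one, one_smul,
      LinearMap.trace_one, hH, smul_eq_mul,
      inv_mul_cancel₀ (Nat.cast_ne_zero.2 Fintype.card_ne_zero)]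
  · intro t _ ht
    rw [map_smul, hW.trace_op_eq_zero hV hS (smul_ne_zero ht hv), smul_zero]
  · simp

theorem IsWeylSystem.trace_lineProj_mul [FiniteDimensional F V] (hV : finrank F V = 2)
    (hS : IsSymplecticForm S) (hH : finrank ℂ H = Fintype.card F)
    (hW : IsWeylSystem S W) (y z : V) {u v : V} (huv : LinearIndependent F ![u, v]) :
    LinearMap.trace ℂ H (lineProj S W y u * lineProj S W z v) = 1 / (Fintype.card F : ℂ) := by
  have : FiniteDimensional ℂ H := FiniteDimensional.of_finrank_pos (hH ▸ Fintype.card_pos)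
  have hu : u ≠ 0 := huv.ne_zero 0
  have hv : v ≠ 0 := huv.ne_zero 1
  conv_lhs => enter [2, 1]; unfold lineProj
  rw [smul_mul_assoc, Finset.sum_mul, map_smul, map_sum, Finset.sum_eq_single 0]
  · rw [zero_mul, sgn_zero, zero_smul, hW.zero, map_one, Circle.coe_one, one_smul, one_mul,
      hW.trace_lineProj hV hS hH z hv, smul_eq_mul, mul_one, one_div]
  · intro s _ hs
    rw [smul_mul_assoc, map_smul, lineProj, mul_smul_comm, map_smul, Finset.mul_sum, map_sum,
      Finset.sum_eq_zero, smul_zero, smul_zero]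
    intro t _
    rw [mul_smul_comm, map_smul, ← map_mul]
    obtain ⟨c, hc⟩ := hW.add (s • u) (t • v)
    have hne : s • u + t • v ≠ 0 := fun h0 => hs (LinearIndependent.pair_iff.1 huv s t h0).1
    have h0 := hW.trace_op_eq_zero hV hS hne
    rw [hc, op_phase_mul, map_smul, smul_eq_mul] at h0
    rw [(mul_eq_zero.1 h0).resolve_left c.coe_ne_zero, smul_zero]
  · simp

theorem IsWeylSystem.sum_lineProj (hW : IsWeylSystem S W) {e v : V} (hev : S e v ≠ 0) :
    ∑ s : F, lineProj S W (s • e) v = 1 := by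
  classical
  unfold lineProj
  rw [← Finset.smul_sum, Finset.sum_comm]
  simp_rw [← Finset.sum_smul]
  have (t : F) : ∑ s : F, (sgn (t * S (s • e) v) : ℂ) =
      if t = 0 then (Fintype.card F : ℂ) else 0 := by
    have := sum_sgn_mul (t * S e v)
    simp only [mul_eq_zero, hev, or_false] at this
    rw [← this]
    refine Finset.sum_congr rfl fun s _ => ?_
    rw [map_smul, LinearMap.smul_apply, smul_eq_mul, mul_left_comm]
  simp_rw [this, ite_smul, zero_smul]
  rw [Finset.sum_ite_eq' , if_pos (Finset.mem_univ _), zero_smul, hW.zero, map_one, smul_smul,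
    inv_mul_cancel₀ (Nat.cast_ne_zero.2 Fintype.card_ne_zero), one_smul]

theorem IsWeylSystem.conj_lineProj (hW : IsWeylSystem S W) (u y v : V) :
    conj (W u) (lineProj S W y v) = lineProj S W (y + u) v := by
  simp only [lineProj, conj_eq, mul_smul_comm, smul_mul_assoc, Finset.mul_sum, Finset.sum_mul]
  congr 1
  refine Finset.sum_congr rfl fun t _ => ?_
  rw [← conj_eq, hW.conj_op, smul_smul, ← Circle.coe_mul, ← sgn_add, map_smul, smul_eq_mul,
    map_add, LinearMap.add_apply, mul_add]

/-- An operator `U` with `U W(u) U* = W(A u)` maps the projection of a line to that of its image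
under `A`. -/
theorem conj_lineProj_of_intertwine {U : H ≃ₗᵢ[ℂ] H} {A : V → V}
    (hA : ∀ (c : F) v, A (c • v) = c • A v) (hAS : ∀ u v, S (A u) (A v) = S u v)
    (hU : ∀ v, U * W v = W (A v) * U) (y v : V) :
    conj U (lineProj S W y v) = lineProj S W (A y) (A v) := by
  simp only [lineProj, conj_eq, mul_smul_comm, smul_mul_assoc, Finset.mul_sum, Finset.sum_mul]
  congr 1
  refine Finset.sum_congr rfl fun t _ => ?_
  rw [← map_mul, ← map_mul, hU, mul_assoc, mul_inv_cancel, mul_one, hA, hAS]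

end

end Weyl

/-! ### Existence and irreducibility of Weyl systems -/

section Weyl

variable {H : Type*} [NormedAddCommGroup H] [InnerProductSpace ℂ H]

theorem exists_orthonormalBasis_of_card {ι : Type*} [Fintype ι] [Nonempty ι]
    (hH : finrank ℂ H = Fintype.card ι) {e : ι → H} (he : Orthonormal ℂ e) :
    ∃ b : OrthonormalBasis ι ℂ H, ∀ i, b i = e i := by
  have h := coe_basisOfOrthonormalOfCardEqFinrank he hH.symm
  refine ⟨(basisOfOrthonormalOfCardEqFinrank he hH.symm).toOrthonormalBasis (by rwa [h]),
    fun i => ?_⟩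
  rw [Basis.coe_toOrthonormalBasis, h]

theorem ext_orthonormalBasis {ι : Type*} [Fintype ι] (b : OrthonormalBasis ι ℂ H)
    {U U' : H ≃ₗᵢ[ℂ] H} (h : ∀ i, U (b i) = U' (b i)) : U = U' := by
  have : op U = op U' := b.toBasis.ext fun i => by simpa using h i
  ext x
  exact LinearMap.congr_fun this x

/-- Commuting operators whose squares are nonzero scalars have a common eigenvector. -/
theorem exists_common_eigenvector [FiniteDimensional ℂ H] [Nontrivial H] {ι : Type*}
    (T : ι → End ℂ H) (hT : ∀ i j, Commute (T i) (T j))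
    (hsq : ∀ i, ∃ c : ℂ, c ≠ 0 ∧ T i * T i = c • 1) :
    ∃ φ : H, φ ≠ 0 ∧ ∀ i, ∃ c : ℂ, T i φ = c • φ := by
  have hss (i : ι) : (T i).IsFinitelySemisimple := by
    obtain ⟨c, hc, h⟩ := hsq i
    refine End.IsSemisimple.isFinitelySemisimple
      (End.isSemisimple_of_squarefree_aeval_eq_zero (p := Polynomial.X ^ 2 - Polynomial.C c) ?_ ?_)
    · exact (Polynomial.separable_X_pow_sub_C c (by norm_num) hc).squarefree
    · rw [map_sub, map_pow, Polynomial.aeval_X, Polynomial.aeval_C, pow_two, h,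
        Algebra.algebraMap_eq_smul_one, sub_self]
  have htop := End.iSup_iInf_maxGenEigenspace_eq_top_of_iSup_maxGenEigenspace_eq_top_of_commute T
    (fun i j _ => hT i j) fun i => End.iSup_maxGenEigenspace_eq_top (T i)
  obtain ⟨χ, hχ⟩ : ∃ χ : ι → ℂ, (⨅ i, (T i).maxGenEigenspace (χ i)) ≠ ⊥ := by
    by_contra! h
    simp only [h, iSup_bot] at htop
    exact bot_ne_top htop
  obtain ⟨φ, hφ, hφ0⟩ := Submodule.exists_mem_ne_zero_of_ne_bot hχ
  refine ⟨φ, hφ0, fun i => ⟨χ i, ?_⟩⟩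
  have := (Submodule.mem_iInf _).1 hφ i
  rw [(hss i).maxGenEigenspace_eq_eigenspace] at this
  exact End.mem_eigenspace_iff.1 this

theorem eq_one_of_phase_apply {c : Circle} {x : H} (hx : x ≠ 0) (h : phase c x = x) : c = 1 := by
  refine Circle.ext (smul_left_injective ℂ hx ?_)
  simpa using h

variable {F : Type*} [Field F] {V : Type*} [AddCommGroup V] [Module F V]

theorem eq_span_singleton {D : Submodule F V} (hD : finrank F D = 1) {v : V} (hv : v ∈ D)
    (hv0 : v ≠ 0) : D = Submodule.span F {v} := by
  have : FiniteDimensional F D := FiniteDimensional.of_finrank_pos (by omega)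
  exact (Submodule.eq_of_le_of_finrank_eq ((Submodule.span_singleton_le_iff_mem _ _).2 hv)
    (by rw [finrank_span_singleton hv0, hD])).symm

/-- If the operators `T d` with `d ∈ D` of a projective representation have a common eigenvector
`φ D` for each one-dimensional `D`, their phases can be adjusted so that they fix it. The
representation is then an ordinary one on each `D`. -/
theorem exists_phase_adjustment [Nontrivial V] {T : V → (H ≃ₗᵢ[ℂ] H)}
    (hT : ∀ u v, ∃ c : Circle, T (u + v) = phase c * (T u * T v)) {φ : Submodule F V → H}
    (hφ : ∀ D : Submodule F V, finrank F D = 1 → φ D ≠ 0 ∧ ∀ d ∈ D, ∃ c : ℂ, T d (φ D) = c • φ D) :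
    ∃ κ : V → Circle,
      (∀ D : Submodule F V, finrank F D = 1 → ∀ d ∈ D, phase (κ d) (T d (φ D)) = φ D) ∧
      (∀ u v, ∃ c : Circle,
        phase (κ (u + v)) * T (u + v) = phase c * (phase (κ u) * T u * (phase (κ v) * T v))) ∧
      ∀ (v : V) (a b : F), phase (κ ((a + b) • v)) * T ((a + b) • v) =
        phase (κ (a • v)) * T (a • v) * (phase (κ (b • v)) * T (b • v)) := by
  have h1 (v : V) : ∃ k : Circle, ∀ D : Submodule F V, finrank F D = 1 → v ∈ D →
      phase k (T v (φ D)) = φ D := by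
    by_cases hv : v = 0
    · subst hv
      obtain ⟨c, hc⟩ := hT 0 0
      refine ⟨c, fun D _ _ => ?_⟩
      rw [add_zero, ← mul_assoc, right_eq_mul] at hc
      exact congrArg (fun U : H ≃ₗᵢ[ℂ] H => U (φ D)) hc
    · have hfr : finrank F (Submodule.span F {v}) = 1 := finrank_span_singleton hv
      obtain ⟨h0, h⟩ := hφ _ hfr
      obtain ⟨c, hc⟩ := h v (Submodule.mem_span_singleton_self v)
      have hn : ‖c‖ = 1 := by
        have := congrArg norm hc
        rw [LinearIsometryEquiv.norm_map, norm_smul] at this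
        exact (mul_eq_right₀ (norm_ne_zero_iff.2 h0)).1 this.symm
      let z : Circle := ⟨c, mem_sphere_zero_iff_norm.2 hn⟩
      have hz : (z : ℂ) = c := rfl
      refine ⟨z⁻¹, fun D hD hvD => ?_⟩
      rw [eq_span_singleton hD hvD hv, hc, phase_apply, smul_smul, ← hz, ← Circle.coe_mul,
        inv_mul_cancel, Circle.coe_one, one_smul]
  choose κ hκ using h1
  have hadd (u v : V) : ∃ c : Circle,
      phase (κ (u + v)) * T (u + v) = phase c * (phase (κ u) * T u * (phase (κ v) * T v)) := by
    obtain ⟨c, hc⟩ := hT u v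
    refine ⟨κ (u + v) * c * (κ u * κ v)⁻¹, ?_⟩
    rw [hc, mul_assoc (phase (κ u)), phase_mul_left_comm (κ v), phase_mul_mul (κ u),
      phase_mul_mul _ (κ u * κ v), inv_mul_cancel_right, phase_mul_mul]
  have hline (D : Submodule F V) (hD : finrank F D = 1) (d d' : V) (hd : d ∈ D) (hd' : d' ∈ D) :
      phase (κ (d + d')) * T (d + d') = phase (κ d) * T d * (phase (κ d') * T d') := by
    obtain ⟨c, hc⟩ := hadd d d'
    have h2 := congrArg (fun U : H ≃ₗᵢ[ℂ] H => U (φ D)) hc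
    simp only [unitary_mul_apply, hκ _ D hD hd', hκ _ D hD hd,
      hκ _ D hD (D.add_mem hd hd')] at h2
    rw [hc, eq_one_of_phase_apply (hφ D hD).1 h2.symm, map_one, one_mul]
  refine ⟨κ, fun D hD d hd => hκ d D hD hd, hadd, fun v a b => ?_⟩
  obtain ⟨w, hw, hvw⟩ : ∃ w : V, w ≠ 0 ∧ v ∈ Submodule.span F {w} := by
    by_cases hv : v = 0
    · obtain ⟨w, hw⟩ := exists_ne (0 : V)
      exact ⟨w, hw, hv ▸ Submodule.zero_mem _⟩
    · exact ⟨v, hv, Submodule.mem_span_singleton_self v⟩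
  rw [add_smul]
  exact hline _ (finrank_span_singleton hw) _ _ (Submodule.smul_mem _ _ hvw)
    (Submodule.smul_mem _ _ hvw)

variable [CharP F 2] [Fintype F] [FiniteDimensional F V]

/-- Weyl systems exist: translations and modulations of functions on `F` give one, up to phases. -/
theorem exists_isWeylSystem (hV : finrank F V = 2) {S : LinearMap.BilinForm F V}
    (hS : IsSymplecticForm S) (hH : finrank ℂ H = Fintype.card F) :
    ∃ W : V → (H ≃ₗᵢ[ℂ] H), IsWeylSystem S W := by
  have : FiniteDimensional ℂ H := FiniteDimensional.of_finrank_pos (hH ▸ Fintype.card_pos)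
  have : Nontrivial H := nontrivial_of_finrank_pos (R := ℂ) (hH ▸ Fintype.card_pos)
  have : Nontrivial V := nontrivial_of_finrank_pos (R := F) (by omega)
  let b : OrthonormalBasis F ℂ H :=
    (stdOrthonormalBasis ℂ H).reindex (Fintype.equivOfCardEq (by simp [hH]))
  let bV := finBasisOfFinrankEq F V hV
  let α : V → F := fun v => bV.repr v 0 * S (bV 0) (bV 1)
  let β : V → F := fun v => bV.repr v 1
  have hα (u v) : α (u + v) = α u + α v := by simp [α, add_mul]
  have hβ (u v) : β (u + v) = β u + β v := by simp [β]
  have hSαβ (u v) : sgn (S u v) = sgn (β u * α v) * sgn (β v * α u) := by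
    rw [← sgn_add, alt_apply_eq hS.2 bV]
    congr 1
    simp only [α, β]
    linear_combination -(β u * α v) * CharTwo.two_eq_zero (R := F)
  have hex (v : V) : ∃ U : H ≃ₗᵢ[ℂ] H, ∀ x, U (b x) = (sgn (β v * x) : ℂ) • b (x + α v) := by
    have horth : Orthonormal ℂ fun x => (sgn (β v * x) : ℂ) • b (x + α v) := by
      refine ⟨fun x => ?_, fun x y hxy => ?_⟩
      · rw [norm_smul, Circle.norm_coe, b.norm_eq_one, mul_one]
      · change inner ℂ ((sgn (β v * x) : ℂ) • b (x + α v)) ((sgn (β v * y) : ℂ) • b (y + α v)) = 0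
        rw [inner_smul_left, inner_smul_right, b.inner_eq_zero (by simpa using hxy)]
        simp
    obtain ⟨b', hb'⟩ := exists_orthonormalBasis_of_card hH horth
    exact ⟨b.equiv b' (Equiv.refl _), fun x => by simp [hb']⟩
  choose T hT using hex
  have hmul (u v : V) : T u * T v = phase (sgn (β u * α v)) * T (u + v) := by
    refine ext_orthonormalBasis b fun x => ?_
    simp only [unitary_mul_apply, hT, map_smul, phase_apply, smul_smul, hα, hβ]
    rw [← Circle.coe_mul, ← Circle.coe_mul, ← sgn_add, ← sgn_add]
    congr 1
    · congr 2; ring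
    · congr 1; ring
  have hadd (u v : V) : T (u + v) = phase (sgn (β u * α v)) * (T u * T v) := by
    rw [hmul, phase_mul_mul, sgn_mul_self, map_one, one_mul]
  have hcomm (u v : V) : T u * T v = phase (sgn (S u v)) * (T v * T u) := by
    rw [hmul, hmul v, phase_mul_mul, hSαβ, mul_assoc, sgn_mul_self, mul_one, add_comm]
  have h0 : T 0 = 1 := by
    refine ext_orthonormalBasis b fun x => ?_
    rw [hT]
    simp [α, β, sgn_zero]
  have hφ (D : Submodule F V) : ∃ φ : H, finrank F D = 1 →
      φ ≠ 0 ∧ ∀ d ∈ D, ∃ c : ℂ, T d φ = c • φ := by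
    by_cases hD : finrank F D = 1
    · obtain ⟨φ, hφ0, hφ⟩ := exists_common_eigenvector (fun d : D => op (T d)) (fun d d' => by
        obtain ⟨w, hw⟩ := finrank_eq_one_iff'.1 hD
        obtain ⟨a, ha⟩ := hw.2 d
        obtain ⟨a', ha'⟩ := hw.2 d'
        have hS0 : S d d' = 0 := by
          have : S (w : V) (w : V) = 0 := hS.2 _
          rw [← ha, ← ha']
          simp [this]
        rw [Commute, SemiconjBy, ← map_mul, ← map_mul, hcomm, hS0, sgn_zero, map_one, one_mul])
        fun d => ⟨sgn (β d * α d), Circle.coe_ne_zero _, by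
          have : (d : V) + d = 0 := by
            rw [← two_smul F (d : V), CharTwo.two_eq_zero, zero_smul]
          rw [← map_mul, hmul, this, h0, mul_one, op_phase]⟩
      exact ⟨φ, fun _ => ⟨hφ0, fun d hd => hφ ⟨d, hd⟩⟩⟩
    · exact ⟨0, fun h => absurd h hD⟩
  choose φ hφ using hφ
  obtain ⟨κ, -, h1, h2⟩ := exists_phase_adjustment (fun u v => ⟨_, hadd u v⟩) hφ
  refine ⟨fun v => phase (κ v) * T v, h1, fun u v => ?_, h2⟩
  simp only [mul_assoc, phase_mul_left_comm _ (T _)]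
  rw [hcomm]
  simp only [phase_mul_mul]
  congr 2
  ac_rfl

namespace IsWeylSystem

variable {S : LinearMap.BilinForm F V} {W : V → (H ≃ₗᵢ[ℂ] H)}

/-- In a suitable orthonormal basis indexed by `F`, the operators of a Weyl system along two
complementary lines act as translations and modulations. -/
theorem exists_frame (hW : IsWeylSystem S W) (hV : finrank F V = 2) (hS : IsSymplecticForm S)
    (hH : finrank ℂ H = Fintype.card F) {u v : V} (huv : S u v ≠ 0) :
    ∃ b : OrthonormalBasis F ℂ H, (∀ a x, W (a • u) (b x) = b (x + a)) ∧
      ∀ c x, W (c • v) (b x) = (sgn (c * x * S u v) : ℂ) • b x := by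
  have hv : v ≠ 0 := by rintro rfl; simp at huv
  obtain ⟨ψ, hψ⟩ : ∃ ψ, lineProj S W 0 v ψ ≠ 0 := by
    by_contra! h
    have h1 := hW.trace_lineProj hV hS hH 0 hv
    rw [show lineProj S W 0 v = 0 from LinearMap.ext h, map_zero] at h1
    exact zero_ne_one h1
  have hfix0 (c : F) : W (c • v) (lineProj S W 0 v ψ) = lineProj S W 0 v ψ := by
    have := LinearMap.congr_fun (hW.op_mul_lineProj 0 v c) ψ
    simpa [sgn_zero] using this
  set φ : H := ((‖lineProj S W 0 v ψ‖ : ℂ)⁻¹) • lineProj S W 0 v ψ with hφ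
  have hφ1 : ‖φ‖ = 1 := by
    rw [hφ, norm_smul, norm_inv, Complex.norm_real, norm_norm,
      inv_mul_cancel₀ (norm_ne_zero_iff.2 hψ)]
  have hfix (c : F) : W (c • v) φ = φ := by rw [hφ, map_smul, hfix0]
  have heig (c x : F) : W (c • v) (W (x • u) φ) = (sgn (c * x * S u v) : ℂ) • W (x • u) φ := by
    have := congrArg (fun U : H ≃ₗᵢ[ℂ] H => U φ) (hW.comm (c • v) (x • u))
    simp only [unitary_mul_apply, hfix, phase_apply] at this
    rw [this, hS.comm]
    simp only [map_smul, LinearMap.smul_apply, smul_eq_mul]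
    congr 3
    ring
  have horth : Orthonormal ℂ fun x : F => W (x • u) φ := by
    refine ⟨fun x => by rw [LinearIsometryEquiv.norm_map, hφ1], fun x y hxy => ?_⟩
    obtain ⟨c, hc⟩ := exists_sgn_mul_eq_neg_one (mul_ne_zero (sub_ne_zero.2 hxy) huv)
    have h1 := LinearIsometryEquiv.inner_map_map (W (c • v)) (W (x • u) φ) (W (y • u) φ)
    rw [heig, heig, inner_smul_left, inner_smul_right, conj_sgn, ← mul_assoc, ← Circle.coe_mul,
      ← sgn_add, show c * x * S u v + c * y * S u v = c * ((x - y) * S u v) by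
        rw [CharTwo.sub_eq_add]; ring, hc] at h1
    rw [Circle.coe_neg, Circle.coe_one] at h1
    linear_combination (-1 / 2 : ℂ) * h1
  obtain ⟨b, hb⟩ := exists_orthonormalBasis_of_card hH horth
  refine ⟨b, fun a x => ?_, fun c x => ?_⟩
  · rw [hb, hb, add_comm, hW.line]
    rfl
  · rw [hb, heig]

/-- A Weyl system is irreducible. -/
theorem exists_eq_phase_of_commute (hW : IsWeylSystem S W) (hV : finrank F V = 2)
    (hS : IsSymplecticForm S) (hH : finrank ℂ H = Fintype.card F) {M : H ≃ₗᵢ[ℂ] H}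
    (hM : ∀ v, M * W v = W v * M) : ∃ c, M = phase c := by
  let bV := finBasisOfFinrankEq F V hV
  have hs := hS.basis_ne_zero bV
  obtain ⟨b, h1, h2⟩ := hW.exists_frame hV hS hH hs
  have hM' (v : V) (x : H) : M (W v x) = W v (M x) :=
    congrArg (fun U : H ≃ₗᵢ[ℂ] H => U x) (hM v)
  have h0 : M (b 0) = inner ℂ (b 0) (M (b 0)) • b 0 := by
    conv_lhs => rw [← b.sum_repr' (M (b 0))]
    refine Finset.sum_eq_single 0 (fun x _ hx => ?_) (by simp)
    obtain ⟨c, hc⟩ := exists_sgn_mul_eq_neg_one (mul_ne_zero hx hs)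
    have h3 : W (c • bV 1) (M (b 0)) = M (b 0) := by
      rw [← hM', h2]
      simp [sgn_zero]
    have h4 := LinearIsometryEquiv.inner_map_map (W (c • bV 1)) (b x) (M (b 0))
    rw [h3, h2, inner_smul_left, conj_sgn, mul_assoc, hc, Circle.coe_neg, Circle.coe_one] at h4
    rw [show inner ℂ (b x) (M (b 0)) = 0 by linear_combination (-1 / 2 : ℂ) * h4, zero_smul]
  generalize (inner ℂ (b 0) (M (b 0)) : ℂ) = z at h0
  have hn : ‖z‖ = 1 := by
    have := congrArg norm h0
    rw [LinearIsometryEquiv.norm_map, norm_smul, b.norm_eq_one, mul_one] at this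
    exact this.symm
  refine ⟨⟨_, mem_sphere_zero_iff_norm.2 hn⟩, ext_orthonormalBasis b fun x => ?_⟩
  have h3 := h1 x 0
  rw [zero_add] at h3
  rw [← h3, hM', h0, map_smul]
  rfl

/-- Elements of `SL(V)` are implemented by unitary operators, up to phases: the two frames given by
a basis of `V` and by its image differ by such an operator. -/
theorem exists_intertwiner (hW : IsWeylSystem S W) (hV : finrank F V = 2)
    (hS : IsSymplecticForm S) (hH : finrank ℂ H = Fintype.card F) (A : SpecialLinearGroup F V) :
    ∃ U : H ≃ₗᵢ[ℂ] H, ∀ v, ∃ c : Circle, U * W v = phase c * (W (A.1 v) * U) := by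
  let bV := finBasisOfFinrankEq F V hV
  have hs := hS.basis_ne_zero bV
  obtain ⟨b, h1, h2⟩ := hW.exists_frame hV hS hH hs
  obtain ⟨b', h1', h2'⟩ := hW.exists_frame (u := A.1 (bV 0)) (v := A.1 (bV 1)) hV hS hH
    (by rwa [alt_map_eq hV hS.2])
  rw [alt_map_eq hV hS.2] at h2'
  let U := b.equiv b' (Equiv.refl _)
  have hU (x : F) : U (b x) = b' x := by simp [U]
  have hU0 (a : F) : U * W (a • bV 0) = W (A.1 (a • bV 0)) * U := by
    refine ext_orthonormalBasis b fun x => ?_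
    rw [map_smul A.1]
    simp only [unitary_mul_apply, h1, hU, h1']
  have hU1 (a : F) : U * W (a • bV 1) = W (A.1 (a • bV 1)) * U := by
    refine ext_orthonormalBasis b fun x => ?_
    rw [map_smul A.1]
    simp only [unitary_mul_apply, h2, hU, h2', map_smul]
  refine ⟨U, fun v => ?_⟩
  have hv : v = bV.repr v 0 • bV 0 + bV.repr v 1 • bV 1 := by
    rw [← Fin.sum_univ_two fun i => bV.repr v i • bV i, bV.sum_repr]
  rw [hv, map_add A.1]
  obtain ⟨c, hc⟩ := hW.add (bV.repr v 0 • bV 0) (bV.repr v 1 • bV 1)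
  obtain ⟨d, hd⟩ := hW.add (A.1 (bV.repr v 0 • bV 0)) (A.1 (bV.repr v 1 • bV 1))
  refine ⟨c * d⁻¹, ?_⟩
  rw [hc, hd, phase_mul_left_comm, ← mul_assoc U, hU0, mul_assoc, hU1, mul_assoc (phase d),
    phase_mul_mul, inv_mul_cancel_right, mul_assoc]

end IsWeylSystem

end Weyl

/-! ### Covariant Weyl systems and their quadrature systems -/

section Averaging

variable {F : Type*} [Field F] {V : Type*} [AddCommGroup V] [Module F V]

theorem SL_pow_succ_apply (A : SpecialLinearGroup F V) (k : ℕ) (v : V) :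
    (A ^ (k + 1)).1 v = (A ^ k).1 (A.1 v) := by
  rw [pow_succ]
  rfl

variable {H : Type*} [NormedAddCommGroup H] [InnerProductSpace ℂ H]
  {S : LinearMap.BilinForm F V} {W : V → (H ≃ₗᵢ[ℂ] H)}

theorem intertwine_pow {U : H ≃ₗᵢ[ℂ] H} {A : SpecialLinearGroup F V}
    (hU : ∀ v, ∃ c : Circle, U * W v = phase c * (W (A.1 v) * U)) (k : ℕ) (v : V) :
    ∃ c : Circle, U ^ k * W v = phase c * (W ((A ^ k).1 v) * U ^ k) := by
  induction k generalizing v with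
  | zero => exact ⟨1, by simp⟩
  | succ k ih =>
    obtain ⟨c, hc⟩ := hU v
    obtain ⟨d, hd⟩ := ih (A.1 v)
    refine ⟨c * d, ?_⟩
    rw [pow_succ, mul_assoc, hc, phase_mul_left_comm, ← mul_assoc (U ^ k), hd, SL_pow_succ_apply,
      mul_assoc, phase_mul_mul, mul_assoc]

theorem intertwine_pow_eq {U : H ≃ₗᵢ[ℂ] H} {A : SpecialLinearGroup F V}
    (hU : ∀ v, U * W v = W (A.1 v) * U) (k : ℕ) (v : V) :
    U ^ k * W v = W ((A ^ k).1 v) * U ^ k := by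
  induction k generalizing v with
  | zero => simp
  | succ k ih => rw [pow_succ, mul_assoc, hU, ← mul_assoc, ih, SL_pow_succ_apply, mul_assoc]

variable [CharP F 2]

theorem IsWeylSystem.intertwine_phase_sq [Nontrivial H] (hW : IsWeylSystem S W) {X : H ≃ₗᵢ[ℂ] H}
    {v w : V} {c : Circle} (h : X * W v = phase c * (W w * X)) : c * c = 1 := by
  have h1 : X * (W v * W v) = phase (c * c) * (W w * W w * X) := by
    rw [← mul_assoc, h, mul_assoc, mul_assoc, h, phase_mul_left_comm, phase_mul_mul, mul_assoc]
  rw [hW.mul_self, hW.mul_self, mul_one, one_mul, right_eq_mul] at h1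
  exact phase_injective (h1.trans (map_one phase).symm)

theorem pow_eq_phase_mul_of_modEq {P : H ≃ₗᵢ[ℂ] H} {N : ℕ} {c : Circle} (hP : P ^ N = phase c)
    {a b : ℕ} (hab : a ≡ b [MOD N]) : ∃ d, P ^ a = phase d * P ^ b := by
  have h (a : ℕ) : P ^ a = phase (c ^ (a / N)) * P ^ (a % N) := by
    conv_lhs => rw [← Nat.div_add_mod a N, pow_add, pow_mul, hP, ← map_pow]
  refine ⟨c ^ (a / N) * (c ^ (b / N))⁻¹, ?_⟩
  rw [h a, h b, phase_mul_mul, inv_mul_cancel_right, hab]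

/-- For `A` of odd order, a Weyl system can be made covariant: its phases can be chosen so that a
unitary operator `P` satisfies `P W(v) P* = W(A v)`. Taking an odd power of a unitary operator that
satisfies this up to signs makes its `N`-th power a scalar, and multiplying the signs over the
`N` powers of `A` gives the correction of `W`, as a product of `N` equal signs is that sign. -/
theorem IsWeylSystem.exists_covariant [Fintype F] [FiniteDimensional F V] (hW : IsWeylSystem S W)
    (hV : finrank F V = 2) (hS : IsSymplecticForm S) (hH : finrank ℂ H = Fintype.card F)
    {A : SpecialLinearGroup F V} {N : ℕ} (hN : Odd N) (hA : A ^ N = 1) :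
    ∃ (W' : V → (H ≃ₗᵢ[ℂ] H)) (P : H ≃ₗᵢ[ℂ] H), IsWeylSystem S W' ∧
      (∀ v, P * W' v = W' (A.1 v) * P) ∧ ∃ c, P ^ N = phase c := by
  have : Nontrivial H := nontrivial_of_finrank_pos (R := ℂ) (hH ▸ Fintype.card_pos)
  have hAN (v : V) : (A ^ N).1 v = v := by rw [hA]; rfl
  obtain ⟨U, hU⟩ := hW.exists_intertwiner hV hS hH A
  obtain ⟨r, hr⟩ : ∃ r, U ^ (2 * N) = phase r := by
    refine hW.exists_eq_phase_of_commute hV hS hH fun v => ?_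
    obtain ⟨c, hc⟩ := intertwine_pow hU N v
    rw [hAN] at hc
    rw [two_mul, pow_add, mul_assoc, hc, phase_mul_left_comm, ← mul_assoc (U ^ N), hc, mul_assoc,
      phase_mul_mul, hW.intertwine_phase_sq hc, map_one, one_mul, mul_assoc]
  let P := U ^ (N + 1)
  obtain ⟨p, hp⟩ : ∃ p, P ^ N = phase p := by
    obtain ⟨k, hk⟩ := hN.add_one
    refine ⟨r ^ k, ?_⟩
    rw [map_pow, ← hr, ← pow_mul, ← pow_mul, hk]
    congr 1
    ring
  have hP (v : V) : ∃ c : Circle, P * W v = phase c * (W (A.1 v) * P) := by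
    obtain ⟨c, hc⟩ := intertwine_pow hU (N + 1) v
    rw [pow_succ A, hA, one_mul] at hc
    exact ⟨c, hc⟩
  choose d hd using intertwine_pow hP
  have hinj {k : ℕ} {v : V} {x y : Circle}
      (h : phase x * (W ((A ^ k).1 v) * P ^ k) = phase y * (W ((A ^ k).1 v) * P ^ k)) : x = y :=
    phase_injective (mul_right_cancel h)
  have hd0 (v : V) : d 0 v = 1 := hinj (k := 0) (v := v) (by rw [← hd]; simp)
  have hdN (v : V) : d N v = 1 := hinj (k := N) (v := v) (by
    rw [← hd, hAN, hp, phase_mul_comm, ← phase_mul_comm, map_one, one_mul, phase_mul_comm])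
  have hdsucc (k : ℕ) (v : V) : d (k + 1) v = d 1 v * d k (A.1 v) :=
    hinj (k := k + 1) (v := v) (by
      have h1 := hd 1 v
      rw [pow_one, pow_one] at h1
      rw [← hd, pow_succ, mul_assoc, h1, phase_mul_left_comm, ← mul_assoc (P ^ k), hd,
        SL_pow_succ_apply, mul_assoc, phase_mul_mul, mul_assoc])
  have hdsq (k : ℕ) (v : V) : d k v * d k v = 1 := hW.intertwine_phase_sq (hd k v)
  have hdline (k : ℕ) (v : V) (a b : F) : d k ((a + b) • v) = d k (a • v) * d k (b • v) :=
    hinj (k := k) (v := (a + b) • v) (by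
      rw [← hd, hW.line, ← mul_assoc, hd, mul_assoc, mul_assoc, hd, phase_mul_left_comm,
        phase_mul_mul, ← mul_assoc (W _) (W _), map_smul, map_smul, map_smul, hW.line])
  let D : V → Circle := fun v => ∏ k ∈ Finset.range N, d k v
  have hDA (v : V) : d 1 v * D v = D (A.1 v) := by
    have h1 : ∏ k ∈ Finset.range N, d (k + 1) v = D v := by
      have := (Finset.prod_range_succ (fun k => d k v) N).symm.trans
        (Finset.prod_range_succ' (fun k => d k v) N)
      rw [hd0, hdN, mul_one, mul_one] at this
      exact this.symm
    have h2 : ∏ k ∈ Finset.range N, d (k + 1) v = d 1 v * D (A.1 v) := by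
      rw [Finset.prod_congr rfl fun k _ => hdsucc k v, Finset.prod_mul_distrib,
        Finset.prod_const, Finset.card_range]
      congr 1
      obtain ⟨m, rfl⟩ := hN
      rw [pow_succ, pow_mul, pow_two, hdsq, one_pow, one_mul]
    rw [← h1, h2, ← mul_assoc, hdsq, one_mul]
  refine ⟨fun v => phase (D v) * W v, P, ⟨fun u v => ?_, fun u v => ?_, fun v a b => ?_⟩,
    fun v => ?_, p, hp⟩
  · obtain ⟨c, hc⟩ := hW.add u v
    refine ⟨D (u + v) * c * (D u * D v)⁻¹, ?_⟩
    rw [hc, mul_assoc (phase (D u)), phase_mul_left_comm (D v), phase_mul_mul (D u),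
      phase_mul_mul _ (D u * D v), inv_mul_cancel_right, phase_mul_mul]
  · simp only [mul_assoc, phase_mul_left_comm _ (W _)]
    rw [hW.comm]
    simp only [phase_mul_mul]
    congr 2
    ac_rfl
  · have : D ((a + b) • v) = D (a • v) * D (b • v) := by
      simp only [D, hdline, Finset.prod_mul_distrib]
    rw [hW.line, this, mul_assoc (phase (D (a • v))), phase_mul_left_comm, phase_mul_mul]
  · have h1 := hd 1 v
    rw [pow_one, pow_one] at h1
    change P * (phase (D v) * W v) = phase (D (A.1 v)) * W (A.1 v) * P
    rw [phase_mul_left_comm, h1, phase_mul_mul, ← hDA, mul_comm (D v), mul_assoc]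

end Averaging

section Construction

variable {F : Type*} [Field F] {V : Type*} [AddCommGroup V] [Module F V]
  {Ω : Type*} [AddTorsor V Ω]

theorem Line.exists_mem (l : Line F V Ω) : ∃ x, x ∈ l.1 := by
  by_contra! h
  have : l.1 = ⊥ := by
    ext x
    exact iff_of_false (h x) (AffineSubspace.notMem_bot F V x)
  have h1 := l.2
  rw [this, AffineSubspace.direction_bot, finrank_bot] at h1
  exact zero_ne_one h1

theorem Line.exists_direction_eq (l : Line F V Ω) :
    ∃ v, v ≠ 0 ∧ l.1.direction = Submodule.span F {v} := by
  obtain ⟨v, hv, -⟩ := finrank_eq_one_iff'.1 l.2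
  have hv0 : (v : V) ≠ 0 := fun h => hv (Subtype.ext h)
  exact ⟨v, hv0, eq_span_singleton l.2 v.2 hv0⟩

theorem Line.eq_mk' (l : Line F V Ω) {x : Ω} (hx : x ∈ l.1) : l = Line.mk' x l.1.direction l.2 :=
  Subtype.ext (AffineSubspace.mk'_eq hx).symm

theorem mem_span_of_form_eq_zero [CharP F 2] (hV : finrank F V = 2) {S : LinearMap.BilinForm F V}
    (hS : IsSymplecticForm S) {u v : V}
    (hv : v ≠ 0) (huv : S u v = 0) : u ∈ Submodule.span F {v} := by
  obtain ⟨b, rfl⟩ := exists_basis_of_ne_zero hV hv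
  have h0 : S (b 0) (b 0) = 0 := hS.2 _
  have h1 : S (b 1) (b 0) ≠ 0 := by rw [hS.comm]; exact hS.basis_ne_zero b
  rw [← b.sum_repr u, Fin.sum_univ_two] at huv ⊢
  simp only [map_add, map_smul, LinearMap.add_apply, LinearMap.smul_apply, smul_eq_mul, h0,
    mul_zero, zero_add, mul_eq_zero, h1, or_false] at huv
  rw [huv, zero_smul, add_zero]
  exact Submodule.smul_mem _ _ (Submodule.mem_span_singleton_self _)

variable [CharP F 2] {H : Type*} [NormedAddCommGroup H] [InnerProductSpace ℂ H]
  [Fintype F]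

/-- The quadrature system of a Weyl system `W`: the line through `o + y` with direction spanned
by `v` is mapped to `lineProj S W y v`. -/
def quadrature (S : LinearMap.BilinForm F V) (W : V → (H ≃ₗᵢ[ℂ] H)) (o : Ω) (l : Line F V Ω) :
    H →ₗ[ℂ] H :=
  lineProj S W (l.exists_mem.choose -ᵥ o) l.exists_direction_eq.choose

variable {S : LinearMap.BilinForm F V} {W : V → (H ≃ₗᵢ[ℂ] H)} {o : Ω}

theorem quadrature_eq (hS : IsSymplecticForm S) (l : Line F V Ω) {x : Ω} (hx : x ∈ l.1) {v : V}
    (hv : v ∈ l.1.direction) (hv0 : v ≠ 0) : quadrature S W o l = lineProj S W (x -ᵥ o) v := by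
  obtain ⟨hw0, hw⟩ := l.exists_direction_eq.choose_spec
  have hx' := l.exists_mem.choose_spec
  rw [quadrature]
  generalize l.exists_direction_eq.choose = w at *
  generalize l.exists_mem.choose = x' at *
  have hdir := eq_span_singleton l.2 hv hv0
  have h1 : w ∈ Submodule.span F {v} := by
    rw [← hdir, hw]
    exact Submodule.mem_span_singleton_self w
  obtain ⟨c, rfl⟩ := Submodule.mem_span_singleton.1 h1
  have h2 : x' -ᵥ x ∈ Submodule.span F {v} := by
    rw [← hdir]
    exact AffineSubspace.vsub_mem_direction hx' hx
  obtain ⟨d, hd⟩ := Submodule.mem_span_singleton.1 h2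
  rw [lineProj_smul_right _ _ (fun hc => hw0 (by rw [hc, zero_smul])),
    ← vsub_add_vsub_cancel x' x o, ← hd, add_comm, lineProj_add_smul hS]

theorem quadrature_mk' (hS : IsSymplecticForm S) (x : Ω) {D : Submodule F V}
    (hD : finrank F D = 1) {v : V} (hv : v ∈ D) (hv0 : v ≠ 0) :
    quadrature S W o (Line.mk' x D hD) = lineProj S W (x -ᵥ o) v :=
  quadrature_eq hS _ (AffineSubspace.self_mem_mk' x D)
    (by rw [Line.mk', AffineSubspace.direction_mk']; exact hv) hv0

theorem quadrature_map (hS : IsSymplecticForm S) (e : Ω ≃ᵃ[F] Ω) (l : Line F V Ω) {x : Ω}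
    (hx : x ∈ l.1) {v : V} (hv : v ∈ l.1.direction) (hv0 : v ≠ 0) :
    quadrature S W o (l.map e) = lineProj S W (e x -ᵥ o) (e.linear v) := by
  refine quadrature_eq hS _ (AffineSubspace.mem_map.2 ⟨x, hx, rfl⟩) ?_ (by simpa using hv0)
  rw [Line.map, AffineSubspace.map_direction]
  exact ⟨v, hv, rfl⟩

variable [FiniteDimensional F V]

/-- Everything follows from the vanishing of the trace of `W v` for `v ≠ 0` and the orthogonality of
the characters of `F`. -/
theorem IsWeylSystem.isQuadratureSystem (hW : IsWeylSystem S W) (hV : finrank F V = 2)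
    (hS : IsSymplecticForm S) (hH : finrank ℂ H = Fintype.card F) :
    IsQuadratureSystem (quadrature S W o : Line F V Ω → _) where
  isProjection l := ⟨hW.lineProj_mul_self _ _, hW.isSymmetric_lineProj _ _⟩
  rank_one l := by
    have : FiniteDimensional ℂ H := FiniteDimensional.of_finrank_pos (hH ▸ Fintype.card_pos)
    have h1 := LinearMap.IsProj.trace
      (LinearMap.IsIdempotentElem.isProj_range _ (hW.lineProj_mul_self (l.exists_mem.choose -ᵥ o)
        l.exists_direction_eq.choose))
    rw [hW.trace_lineProj hV hS hH _ l.exists_direction_eq.choose_spec.1] at h1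
    exact_mod_cast h1.symm
  sum_parallel D hD := by
    obtain ⟨v', hv, -⟩ := finrank_eq_one_iff'.1 hD
    obtain ⟨v, hvD⟩ := v'
    have hv0 : v ≠ 0 := fun h => hv (Subtype.ext h)
    have hDv := eq_span_singleton hD hvD hv0
    obtain ⟨e, he⟩ := hS.exists_ne_zero hV hv0
    rw [hS.comm] at he
    let f : F → {l : Line F V Ω // l.1.direction = D} := fun t =>
      ⟨Line.mk' (t • e +ᵥ o) D hD, AffineSubspace.direction_mk' _ _⟩
    have hSD {w : V} (hw : w ∈ D) : S w v = 0 := by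
      rw [hDv] at hw
      obtain ⟨c, rfl⟩ := Submodule.mem_span_singleton.1 hw
      have : S v v = 0 := hS.2 v
      simp [this]
    have hf : Function.Bijective f := by
      constructor
      · intro t t' h
        have h1 : (t • e +ᵥ o) ∈ AffineSubspace.mk' (t' • e +ᵥ o) D := by
          have h2 : AffineSubspace.mk' (t • e +ᵥ o) D = AffineSubspace.mk' (t' • e +ᵥ o) D :=
            congrArg (fun l => l.1.1) h
          rw [← h2]
          exact AffineSubspace.self_mem_mk' _ _
        rw [AffineSubspace.mem_mk', vadd_vsub_vadd_cancel_right, ← sub_smul] at h1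
        have h2 := hSD h1
        rw [map_smul, LinearMap.smul_apply, smul_eq_mul] at h2
        exact sub_eq_zero.1 ((mul_eq_zero.1 h2).resolve_right he)
      · rintro ⟨l, hl⟩
        obtain ⟨x, hx⟩ := l.exists_mem
        refine ⟨S (x -ᵥ o) v / S e v, Subtype.ext (Subtype.ext ?_)⟩
        change AffineSubspace.mk' _ D = l.1
        subst hl
        refine AffineSubspace.mk'_eq ?_
        rw [← AffineSubspace.vsub_right_mem_direction_iff_mem hx, hDv]
        refine mem_span_of_form_eq_zero hV hS hv0 ?_
        rw [vadd_vsub_assoc, ← neg_vsub_eq_vsub_rev x o]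
        simp only [map_add, map_neg, map_smul, LinearMap.add_apply, LinearMap.neg_apply,
          LinearMap.smul_apply, smul_eq_mul, div_mul_cancel₀ _ he, add_neg_cancel]
    rw [← finsum_comp_equiv (Equiv.ofBijective f hf), finsum_eq_sum_of_fintype]
    refine Eq.trans (Finset.sum_congr rfl fun t _ => ?_) (hW.sum_lineProj he)
    refine (quadrature_mk' hS _ hD hvD hv0).trans ?_
    rw [vadd_vsub]
  trace_mul l₁ l₂ hne := by
    obtain ⟨h1, h1'⟩ := l₁.exists_direction_eq.choose_spec
    obtain ⟨h2, h2'⟩ := l₂.exists_direction_eq.choose_spec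
    rw [Nat.card_eq_fintype_card]
    refine hW.trace_lineProj_mul hV hS hH _ _ ?_
    rw [LinearIndependent.pair_iff' h1]
    intro a ha
    refine hne (h1'.trans ?_)
    rw [h2']
    refine (eq_span_singleton (finrank_span_singleton h1) ?_ h2)
    rw [← ha]
    exact Submodule.smul_mem _ _ (Submodule.mem_span_singleton_self _)

/-- The multiplier of `W` does not depend on the center: the representation centered at `o'` is
`v ↦ (-1) ^ Tr S(o' - o, v) W(v)`, which differs from `W` by a character of `V`. -/
theorem IsWeylSystem.isAssociatedForm [Nontrivial H] (hW : IsWeylSystem S W)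
    (hS : IsSymplecticForm S) :
    IsAssociatedForm (quadrature S W o : Line F V Ω → _) S := by
  choose m hm using hW.add
  refine ⟨hS, m, fun o' => ⟨fun v => phase (sgn (S (o' -ᵥ o) v)) * W v, fun u v x => ?_, ?_, ?_⟩,
    fun u v => ?_⟩
  · change ((phase _ * W (u + v)) : H ≃ₗᵢ[ℂ] H) x =
      (phase (m u v) * ((phase _ * W u) * (phase _ * W v)) : H ≃ₗᵢ[ℂ] H) x
    congr 1
    rw [hm, map_add, sgn_add, mul_assoc, phase_mul_left_comm _ (W u), phase_mul_mul, phase_mul_mul,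
      phase_mul_mul, mul_comm, mul_assoc]
  · intro v l
    obtain ⟨x, hx⟩ := l.exists_mem
    obtain ⟨w, hw0, hw⟩ := l.exists_direction_eq
    have hwl : w ∈ l.1.direction := hw ▸ Submodule.mem_span_singleton_self w
    rw [conj_phase_mul, quadrature_eq hS l hx hwl hw0, hW.conj_lineProj,
      quadrature_map hS _ l hx hwl hw0, AffineEquiv.constVAdd_apply, AffineEquiv.linear_constVAdd,
      vadd_vsub_assoc, add_comm]
    rfl
  · intro D hD d hd
    obtain ⟨v', hv, -⟩ := finrank_eq_one_iff'.1 hD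
    obtain ⟨v, hvD⟩ := v'
    have hv0 : v ≠ 0 := fun h => hv (Subtype.ext h)
    rw [eq_span_singleton hD hvD hv0] at hd
    obtain ⟨c, rfl⟩ := Submodule.mem_span_singleton.1 hd
    rw [quadrature_mk' hS _ hD hvD hv0]
    change op (phase _ * W (c • v)) * lineProj S W (o' -ᵥ o) v = _
    rw [op_phase_mul, smul_mul_assoc, hW.op_mul_lineProj, smul_smul, map_smul, smul_eq_mul,
      ← Circle.coe_mul, sgn_mul_self, Circle.coe_one, one_smul]
  · have h1 : star (m u v : ℂ) = ((m u v)⁻¹ : Circle) := (Circle.coe_inv_eq_conj _).symm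
    have h2 : phase (m u v) * (W u * W v) = phase (m v u) * (W v * W u) := by
      rw [← hm, ← hm, add_comm]
    rw [hW.comm, phase_mul_mul] at h2
    have h3 := phase_injective (mul_right_cancel h2)
    rw [h1, ← h3, ← Circle.coe_mul, inv_mul_cancel_left, sgn, Circle.coe_pow, Circle.coe_neg,
      Circle.coe_one]

/-- Tori admit covariant quadrature systems with any prescribed symplectic form. -/
theorem IsTorus.admitsWithForm (hV : finrank F V = 2)
    (hS : IsSymplecticForm S) (hH : finrank ℂ H = Fintype.card F)
    {G : Subgroup (SpecialLinearGroup F V)} (hG : IsTorus G) (o : Ω) : AdmitsWithForm H o S G := by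
  have hodd := hG.odd_card hV
  obtain ⟨A, -, rfl⟩ := hG
  rw [Nat.card_zpowers] at hodd
  obtain ⟨W₀, hW₀⟩ := exists_isWeylSystem hV hS hH
  obtain ⟨W, P, hW, hP, p, hp⟩ := hW₀.exists_covariant hV hS hH hodd (pow_orderOf_eq_one A)
  have : Nontrivial H := nontrivial_of_finrank_pos (R := ℂ) (hH ▸ Fintype.card_pos)
  refine ⟨quadrature S W o, hW.isQuadratureSystem hV hS hH, ?_, hW.isAssociatedForm hS⟩
  have hex (g : semidirectSubgroup (Subgroup.zpowers A)) :
      ∃ k : ℕ, (A ^ k).1 = (g : AffineGroup F V).right := by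
    obtain ⟨B, hB, hBg⟩ := g.2
    have hfin : IsOfFinOrder A := orderOf_pos_iff.1 hodd.pos
    obtain ⟨k, hk⟩ := hfin.mem_powers_iff_mem_zpowers.2 hB
    exact ⟨k, (congrArg Subtype.val hk).trans hBg⟩
  choose k hk using hex
  let t : semidirectSubgroup (Subgroup.zpowers A) → V := fun g => (g : AffineGroup F V).left.toAdd
  refine ⟨fun g => W (t g) * P ^ k g, ?_, fun g l => ?_⟩
  · have hproj (g h : semidirectSubgroup (Subgroup.zpowers A)) : ∃ c : Circle,
        W (t (g * h)) * P ^ k (g * h) = phase c * (W (t g) * P ^ k g * (W (t h) * P ^ k h)) := by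
      have h1 : t (g * h) = t g + (A ^ k g).1 (t h) := by rw [hk]; rfl
      have h2 : k (g * h) ≡ k g + k h [MOD orderOf A] := by
        rw [← pow_eq_pow_iff_modEq]
        refine Subtype.ext ?_
        rw [hk, pow_add, SpecialLinearGroup.coe_mul, hk, hk]
        rfl
      obtain ⟨c, hc⟩ := hW.add (t g) ((A ^ k g).1 (t h))
      obtain ⟨d, hd⟩ := pow_eq_phase_mul_of_modEq hp h2
      refine ⟨c * d, ?_⟩
      rw [h1, hc, hd, mul_assoc (W (t g)), ← mul_assoc (P ^ k g), intertwine_pow_eq hP,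
        phase_mul_left_comm, mul_assoc, phase_mul_left_comm, pow_add, phase_mul_mul]
      simp only [mul_assoc]
    choose m hm using hproj
    exact ⟨m, fun g h x => congrArg (fun U : H ≃ₗᵢ[ℂ] H => U x) (hm g h)⟩
  · obtain ⟨x, hx⟩ := l.exists_mem
    obtain ⟨w, hw0, hw⟩ := l.exists_direction_eq
    have hwl : w ∈ l.1.direction := hw ▸ Submodule.mem_span_singleton_self w
    rw [quadrature_map hS _ l hx hwl hw0, quadrature_eq hS l hx hwl hw0, conj_mul,
      conj_lineProj_of_intertwine (A := (A ^ k g).1) (map_smul _) (alt_map_eq hV hS.2 _)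
        (intertwine_pow_eq hP _), hW.conj_lineProj, hk]
    congr 1
    exact vadd_vsub _ _

end Construction

/-! ### Covariance excludes involutions -/

section Necessity

variable {F : Type*} [Field F] {V : Type*} [AddCommGroup V] [Module F V]
  {Ω : Type*} [AddTorsor V Ω] {H : Type*} [NormedAddCommGroup H] [InnerProductSpace ℂ H]

theorem Line.map_mk' (e : Ω ≃ᵃ[F] Ω) (x : Ω) {D : Submodule F V} (hD : finrank F D = 1)
    (hD' : finrank F (D.map (e.linear : V →ₗ[F] V)) = 1) :
    (Line.mk' x D hD).map e = Line.mk' (e x) (D.map (e.linear : V →ₗ[F] V)) hD' :=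
  Subtype.ext (AffineSubspace.map_mk' (e : Ω →ᵃ[F] Ω) x D)

theorem IsQuadratureSystem.apply_apply {Q : Line F V Ω → (H →ₗ[ℂ] H)} (hQ : IsQuadratureSystem Q)
    (l : Line F V Ω) (x : H) : Q l (Q l x) = Q l x :=
  LinearMap.congr_fun (hQ.isProjection l).isIdempotentElem x

theorem IsQuadratureSystem.exists_fixed {Q : Line F V Ω → (H →ₗ[ℂ] H)} (hQ : IsQuadratureSystem Q)
    (l : Line F V Ω) : ∃ φ : H, φ ≠ 0 ∧ Q l φ = φ ∧ ∀ x, ∃ c : ℂ, Q l x = c • φ := by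
  obtain ⟨⟨φ, y, hy⟩, hφ, h⟩ := finrank_eq_one_iff'.1 (hQ.rank_one l)
  refine ⟨φ, fun h0 => hφ (Subtype.ext h0), by rw [← hy, hQ.apply_apply], fun x => ?_⟩
  obtain ⟨c, hc⟩ := h ⟨Q l x, x, rfl⟩
  exact ⟨c, (congrArg Subtype.val hc).symm⟩

/-- Different parallel lines have different projections: otherwise a vector in their common range
would have two components of full norm. -/
theorem IsQuadratureSystem.eq_of_parallel [Finite Ω] {Q : Line F V Ω → (H →ₗ[ℂ] H)}
    (hQ : IsQuadratureSystem Q) {l₁ l₂ : Line F V Ω} (hd : l₁.1.direction = l₂.1.direction)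
    (h : Q l₁ = Q l₂) : l₁ = l₂ := by
  classical
  have := finite_line (F := F) (V := V) (Ω := Ω)
  by_contra hne
  obtain ⟨φ, hφ0, hφ, -⟩ := hQ.exists_fixed l₁
  have := Fintype.ofFinite {l : Line F V Ω // l.1.direction = l₁.1.direction}
  have hsum := LinearMap.congr_fun (hQ.sum_parallel l₁.1.direction l₁.2) φ
  rw [finsum_eq_sum_of_fintype, LinearMap.sum_apply, LinearMap.id_apply] at hsum
  have hin (l : Line F V Ω) : inner ℂ φ (Q l φ) = ((‖Q l φ‖ ^ 2 : ℝ) : ℂ) := by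
    rw [← hQ.apply_apply, ← (hQ.isProjection l).isSymmetric φ, hQ.apply_apply,
      inner_self_eq_norm_sq_to_K]
    norm_cast
  have h1 := congrArg (inner ℂ φ) hsum
  simp only [inner_sum, hin] at h1
  have hself : inner ℂ φ φ = ((‖φ‖ ^ 2 : ℝ) : ℂ) := by
    rw [inner_self_eq_norm_sq_to_K]
    norm_cast
  rw [hself] at h1
  have h2 : ∑ l : {l : Line F V Ω // l.1.direction = l₁.1.direction}, ‖Q l.1 φ‖ ^ 2 = ‖φ‖ ^ 2 := by
    exact_mod_cast h1
  let a : {l : Line F V Ω // l.1.direction = l₁.1.direction} := ⟨l₁, rfl⟩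
  let b : {l : Line F V Ω // l.1.direction = l₁.1.direction} := ⟨l₂, hd.symm⟩
  have hab : a ≠ b := fun h => hne (congrArg Subtype.val h)
  have h3 := Finset.sum_le_sum_of_subset_of_nonneg (Finset.subset_univ {a, b})
    (f := fun l => ‖Q l.1 φ‖ ^ 2) (fun i _ _ => by positivity)
  rw [Finset.sum_pair hab, h2] at h3
  simp only [a, b, ← h, hφ] at h3
  have := norm_pos_iff.2 hφ0
  nlinarith

theorem conj_apply_apply (U : H ≃ₗᵢ[ℂ] H) (T : H →ₗ[ℂ] H) (x : H) : conj U T (U x) = U (T x) := by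
  change U (T (U.symm (U x))) = U (T x)
  rw [U.symm_apply_apply]

/-- The commutation relations forced by a transvection `f ↦ f + e`, `e ↦ e` that is implemented by a
unitary operator. It yields that `W (c f)` and `W (c e)` commute for all `c`; since the operators of
the line through `f + c e` commute, so do `W f` and `W (c² e)`; and every element of `F` is a
square. -/
theorem commute_of_transvection [Finite F] [CharP F 2] {W : V → (H ≃ₗᵢ[ℂ] H)}
    (hadd : ∀ u v, ∃ c : Circle, W (u + v) = phase c * (W u * W v))
    (hline : ∀ (v : V) (a b : F), W ((a + b) • v) = W (a • v) * W (b • v))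
    {A : V ≃ₗ[F] V} {P : H ≃ₗᵢ[ℂ] H} (hP : ∀ v, P * W v = W (A v) * P) {e f : V} (he : A e = e)
    (hf : A f = f + e) (a : F) : Commute (W f) (W (a • e)) := by
  have hcl (v : V) (a b : F) : Commute (W (a • v)) (W (b • v)) := by
    rw [Commute, SemiconjBy, ← hline, ← hline, add_comm]
  have hsq (v : V) : W v * W v = 1 := by
    have h0 : W 0 = 1 := by simpa using hline 0 0 0
    have := hline v 1 1
    rw [CharTwo.add_self_eq_zero, zero_smul, one_smul, h0] at this
    exact this.symm
  have hvv (v : V) : v + v = 0 := by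
    rw [← two_smul F v, CharTwo.two_eq_zero, zero_smul]
  have hcef (c : F) : Commute (W (c • f)) (W (c • e)) := by
    obtain ⟨m, hm⟩ := hadd (c • f) (c • e)
    have h1 : A (c • f) = c • f + c • e := by rw [map_smul, hf, smul_add]
    have h2 : A (c • f + c • e) = c • f := by
      rw [map_add, h1, map_smul, he, add_assoc, hvv, add_zero]
    have h3 : A (c • e) = c • e := by rw [map_smul, he]
    have h4 : W (c • f) = phase m * (W (c • f + c • e) * W (c • e)) := by
      refine mul_right_cancel (b := P) ?_
      calc W (c • f) * P = P * W (c • f + c • e) := by rw [hP, h2]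
        _ = phase m * (P * W (c • f) * W (c • e)) := by
          rw [hm, phase_mul_left_comm, mul_assoc]
        _ = _ := by rw [hP, h1, mul_assoc _ P, hP, h3]; simp only [mul_assoc]
    have h5 : phase m * phase m = (1 : H ≃ₗᵢ[ℂ] H) := by
      rw [hm, mul_assoc, mul_assoc, hsq, mul_one, ← mul_assoc, right_eq_mul] at h4
      exact h4
    have h6 := hsq (c • f + c • e)
    rw [hm, mul_assoc, phase_mul_left_comm, ← mul_assoc, h5, one_mul] at h6
    -- the product of two involutions is an involution, so they commute
    have h7 : W (c • f) * W (c • e) = (W (c • f) * W (c • e))⁻¹ := eq_inv_of_mul_eq_one_left h6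
    rwa [mul_inv_rev, inv_eq_of_mul_eq_one_left (hsq _), inv_eq_of_mul_eq_one_left (hsq _)] at h7
  obtain ⟨c, rfl⟩ : ∃ c : F, a = c * c := by
    have := Fintype.ofFinite F
    obtain ⟨c, hc⟩ := FiniteField.isSquare_of_char_two (ringChar.eq F 2 ▸ rfl) a
    exact ⟨c, hc⟩
  have h1 : Commute (W (f + c • e)) (W (c • f + (c * c) • e)) := by
    have := hcl (f + c • e) 1 c
    rwa [one_smul, smul_add c, smul_smul] at this
  obtain ⟨m, hm⟩ := hadd f (c • e)
  obtain ⟨n, hn⟩ := hadd (c • f) ((c * c) • e)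
  have h2 : Commute (W f * W (c • e)) (W (c • f) * W ((c * c) • e)) := by
    have h3 : W f * W (c • e) = phase m⁻¹ * W (f + c • e) := by
      rw [hm, phase_mul_mul, inv_mul_cancel, map_one, one_mul]
    have h4 : W (c • f) * W ((c * c) • e) = phase n⁻¹ * W (c • f + (c * c) • e) := by
      rw [hn, phase_mul_mul, inv_mul_cancel, map_one, one_mul]
    have hc (z : Circle) (X : H ≃ₗᵢ[ℂ] H) : Commute (phase z) X := (phase_mul_comm z X).symm
    rw [h3, h4]
    exact ((hc _ _).mul_left ((hc _ _).symm.mul_right h1))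
  have h3 : Commute (W f) (W (c • f)) := by simpa using hcl f 1 c
  have h4 : Commute (W f * W (c • e)) (W (c • f)) := h3.mul_left (hcef c).symm
  -- cancelling the factor `W (c f)`, which commutes with the left hand side
  have h5 : Commute (W f * W (c • e)) (W ((c * c) • e)) := by
    have := h4.symm.inv_left.symm.mul_right h2
    rwa [inv_mul_cancel_left] at this
  have h6 : Commute (W (c • e)) (W ((c * c) • e)) := hcl e c (c * c)
  have := h5.mul_left h6.inv_left
  rwa [mul_inv_cancel_right] at this

theorem Line.map_constVAdd_mk' (x : Ω) {D : Submodule F V} (hD : finrank F D = 1) (v : V) :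
    (Line.mk' x D hD).map (AffineEquiv.constVAdd F Ω v) = Line.mk' (v +ᵥ x) D hD := by
  have h1 : D.map ((AffineEquiv.constVAdd F Ω v).linear : V →ₗ[F] V) = D := by
    rw [AffineEquiv.linear_constVAdd]
    exact Submodule.map_id D
  rw [Line.map_mk' _ _ hD (by rwa [h1])]
  simp only [h1, AffineEquiv.constVAdd_apply]

theorem Line.mk'_eq_mk'_iff (x y : Ω) {D : Submodule F V} (hD : finrank F D = 1) :
    Line.mk' x D hD = Line.mk' y D hD ↔ x -ᵥ y ∈ D := by
  rw [← AffineSubspace.mem_mk']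
  constructor
  · intro h
    rw [← show AffineSubspace.mk' x D = AffineSubspace.mk' y D from congrArg Subtype.val h]
    exact AffineSubspace.self_mem_mk' _ _
  · intro h
    refine Subtype.ext ?_
    have := AffineSubspace.mk'_eq h
    rwa [AffineSubspace.direction_mk'] at this

theorem affineAction_inl (o : Ω) (v : V) :
    affineAction o (SemidirectProduct.inl (Multiplicative.ofAdd v) : AffineGroup F V) =
      AffineEquiv.constVAdd F Ω v := by
  ext x
  change ((x -ᵥ o) + v) +ᵥ o = v +ᵥ x
  rw [add_comm, add_vadd, vsub_vadd]

theorem affineAction_inr_origin (o : Ω) (A : V ≃ₗ[F] V) :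
    affineAction o (SemidirectProduct.inr A : AffineGroup F V) o = o := by
  change (A (o -ᵥ o) + 0) +ᵥ o = o
  simp

theorem linear_affineAction (o : Ω) (g : AffineGroup F V) :
    (affineAction o g).linear = g.right := rfl

theorem Line.map_affineAction_inr (o : Ω) (A : V ≃ₗ[F] V) {D : Submodule F V}
    (hD : finrank F D = 1) (hD' : finrank F (D.map (A : V →ₗ[F] V)) = 1) :
    (Line.mk' o D hD).map (affineAction o (SemidirectProduct.inr A : AffineGroup F V)) =
      Line.mk' o (D.map (A : V →ₗ[F] V)) hD' := by
  have h : (affineAction o (SemidirectProduct.inr A : AffineGroup F V)).linear = A := by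
    rw [linear_affineAction, SemidirectProduct.right_inr]
  rw [Line.map_mk' _ _ hD (by rwa [h])]
  simp only [h, affineAction_inr_origin]

theorem inr_mul_inl (A : V ≃ₗ[F] V) (v : V) :
    (SemidirectProduct.inr A * SemidirectProduct.inl (Multiplicative.ofAdd v) : AffineGroup F V) =
      SemidirectProduct.inl (Multiplicative.ofAdd (A v)) * SemidirectProduct.inr A := by
  refine SemidirectProduct.ext ?_ ?_
  · change (1 : Multiplicative V) * glAut F V A (Multiplicative.ofAdd v) =
      Multiplicative.ofAdd (A v) * glAut F V 1 1
    rw [one_mul, map_one, mul_one]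
    rfl
  · change A * 1 = 1 * A
    rw [one_mul, mul_one]

/-- A covariant quadrature system determines a projective representation `W` of `V` centered at the
origin, and the symmetries of the system permute the operators of `W` exactly, not only up to
phases, because the phases are fixed by the action on the lines through the origin. -/
theorem IsCovariant.exists_centered [Nontrivial V] {o : Ω} {G : Subgroup (SpecialLinearGroup F V)}
    {Q : Line F V Ω → (H →ₗ[ℂ] H)} (hQ : IsQuadratureSystem Q)
    (hcov : IsCovariant o (semidirectSubgroup G) Q) :
    ∃ W : V → (H ≃ₗᵢ[ℂ] H), (∀ u v, ∃ c : Circle, W (u + v) = phase c * (W u * W v)) ∧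
      (∀ (v : V) (a b : F), W ((a + b) • v) = W (a • v) * W (b • v)) ∧ IsCenteredAt Q o W ∧
      ∀ A ∈ G, ∃ P : H ≃ₗᵢ[ℂ] H, ∀ v, P * W v = W (A.1 v) * P := by
  obtain ⟨U, ⟨μ, hμ⟩, hcov⟩ := hcov
  let t : V → semidirectSubgroup G := fun v =>
    ⟨SemidirectProduct.inl (Multiplicative.ofAdd v), ⟨1, one_mem _, rfl⟩⟩
  have ht (u v : V) : t (u + v) = t u * t v :=
    Subtype.ext (map_mul SemidirectProduct.inl (Multiplicative.ofAdd u) (Multiplicative.ofAdd v))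
  have hUmul (g h : semidirectSubgroup G) : U (g * h) = phase (μ g h) * (U g * U h) :=
    LinearIsometryEquiv.ext fun x => hμ g h x
  have hQt (v : V) (l : Line F V Ω) :
      conj (U (t v)) (Q l) = Q (l.map (AffineEquiv.constVAdd F Ω v)) := by
    rw [← hcov, affineAction_inl]
  have hmapd {D : Submodule F V} (hD : finrank F D = 1) {d : V} (hd : d ∈ D) :
      (Line.mk' o D hD).map (AffineEquiv.constVAdd F Ω d) = Line.mk' o D hD := by
    rw [Line.map_constVAdd_mk', Line.mk'_eq_mk'_iff, vadd_vsub]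
    exact hd
  have hφex (D : Submodule F V) : ∃ φ : H, ∀ hD : finrank F D = 1,
      φ ≠ 0 ∧ Q (Line.mk' o D hD) φ = φ ∧ ∀ x, ∃ c : ℂ, Q (Line.mk' o D hD) x = c • φ := by
    by_cases hD : finrank F D = 1
    · obtain ⟨φ, hφ⟩ := hQ.exists_fixed (Line.mk' o D hD)
      exact ⟨φ, fun _ => hφ⟩
    · exact ⟨0, fun h => absurd h hD⟩
  choose φ hφ using hφex
  obtain ⟨κ, hfix, hadd, hline⟩ := exists_phase_adjustment (T := fun v => U (t v)) (φ := φ)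
    (fun u v => ⟨_, by rw [ht, hUmul]⟩) (fun D hD => ⟨(hφ D hD).1, fun d hd => by
      obtain ⟨-, h1, h2⟩ := hφ D hD
      obtain ⟨c, hc⟩ := h2 (U (t d) (φ D))
      refine ⟨c, ?_⟩
      rw [← hc]
      have h3 := conj_apply_apply (U (t d)) (Q (Line.mk' o D hD)) (φ D)
      rw [hQt, hmapd hD hd, h1] at h3
      exact h3.symm⟩)
  refine ⟨fun v => phase (κ v) * U (t v), hadd, hline, ⟨fun v l => ?_, fun D hD d hd => ?_⟩,
    fun A hA => ?_⟩
  · rw [conj_phase_mul, hQt]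
  · ext x
    obtain ⟨c, hc⟩ := (hφ D hD).2.2 x
    change phase (κ d) (U (t d) (Q (Line.mk' o D hD) x)) = Q (Line.mk' o D hD) x
    have := hfix D hD d hd
    rw [hc, map_smul, map_smul, this]
  let a : semidirectSubgroup G := ⟨SemidirectProduct.inr A.1, ⟨A, hA, rfl⟩⟩
  have hat (v : V) : a * t v = t (A.1 v) * a := Subtype.ext (inr_mul_inl A.1 v)
  refine ⟨U a, fun v => ?_⟩
  obtain ⟨c, hc⟩ : ∃ c : Circle, U a * (phase (κ v) * U (t v)) =
      phase c * (phase (κ (A.1 v)) * U (t (A.1 v)) * U a) := by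
    have h1 : phase (μ a (t v)) * (U a * U (t v)) =
        phase (μ (t (A.1 v)) a) * (U (t (A.1 v)) * U a) := by
      rw [← hUmul, hat, hUmul]
    refine ⟨κ v * (μ a (t v))⁻¹ * μ (t (A.1 v)) a * (κ (A.1 v))⁻¹, ?_⟩
    rw [phase_mul_left_comm, mul_assoc (phase (κ (A.1 v))), phase_mul_mul,
      inv_mul_cancel_right, ← phase_mul_mul _ (μ (t (A.1 v)) a), ← h1, phase_mul_mul,
      inv_mul_cancel_right]
  obtain ⟨w, hw, hvw⟩ : ∃ w : V, w ≠ 0 ∧ v ∈ Submodule.span F {w} := by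
    by_cases hv : v = 0
    · obtain ⟨w, hw⟩ := exists_ne (0 : V)
      exact ⟨w, hw, hv ▸ Submodule.zero_mem _⟩
    · exact ⟨v, hv, Submodule.mem_span_singleton_self v⟩
  have hD : finrank F (Submodule.span F {w}) = 1 := finrank_span_singleton hw
  set D := Submodule.span F {w}
  have hD' : finrank F (D.map (A.1 : V →ₗ[F] V)) = 1 :=
    (LinearEquiv.finrank_map_eq A.1 D).trans hD
  obtain ⟨hφ0, h1, -⟩ := hφ D hD
  obtain ⟨-, -, h2⟩ := hφ _ hD'
  have h3 : ∃ c : ℂ, U a (φ D) = c • φ (D.map (A.1 : V →ₗ[F] V)) := by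
    obtain ⟨c, hc⟩ := h2 (U a (φ D))
    refine ⟨c, ?_⟩
    have h4 := conj_apply_apply (U a) (Q (Line.mk' o D hD)) (φ D)
    have h5 : (Line.mk' o D hD).map (affineAction o (a : AffineGroup F V)) =
        Line.mk' o (D.map (A.1 : V →ₗ[F] V)) hD' :=
      Line.map_affineAction_inr o A.1 hD hD'
    rw [← hcov, h1, h5, hc] at h4
    exact h4.symm
  obtain ⟨z, hz⟩ := h3
  have h4 := hfix D hD v hvw
  have h5 := hfix _ hD' (A.1 v) ⟨v, hvw, rfl⟩
  -- both sides map `φ D` to the same nonzero vector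
  have h6 := congrArg (fun X : H ≃ₗᵢ[ℂ] H => X (φ D)) hc
  simp only [unitary_mul_apply, h4] at h6
  rw [hz, map_smul (U (t (A.1 v))), map_smul (phase (κ (A.1 v))), h5, ← hz] at h6
  have hne : U a (φ D) ≠ 0 := fun h0 => hφ0 ((map_eq_zero_iff _ (U a).injective).1 h0)
  rw [hc, eq_one_of_phase_apply hne h6.symm, map_one, one_mul]

/-- If `W f` commutes with the translations in a complementary direction `e`, then it acts
trivially on the range of each projection `Q l` for `l` parallel to `f`, hence is the identity.
But it translates the lines parallel to `e`. -/
theorem IsCenteredAt.false_of_commute [Finite F] [FiniteDimensional F V] (hV : finrank F V = 2)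
    {o : Ω} {Q : Line F V Ω → (H →ₗ[ℂ] H)} (hQ : IsQuadratureSystem Q) {W : V → (H ≃ₗᵢ[ℂ] H)}
    (hW : IsCenteredAt Q o W) {e f : V} (hli : LinearIndependent F ![f, e])
    (hcomm : ∀ c : F, Commute (W f) (W (c • e))) : False := by
  have : Finite V := Module.finite_of_finite F
  have : Finite Ω := Finite.of_equiv V (Equiv.vaddConst o)
  have hDf : finrank F (Submodule.span F {f}) = 1 := finrank_span_singleton (hli.ne_zero 0)
  have hDe : finrank F (Submodule.span F {e}) = 1 := finrank_span_singleton (hli.ne_zero 1)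
  have hl (l : Line F V Ω) (hl : l.1.direction = Submodule.span F {f}) : op (W f) * Q l = Q l := by
    obtain ⟨x, hx⟩ := l.exists_mem
    have h1 := l.eq_mk' hx
    simp only [hl] at h1
    have h2 : x -ᵥ o ∈ Submodule.span F (Set.range ![f, e]) := by
      rw [hli.span_eq_top_of_card_eq_finrank (by simp [hV])]
      exact Submodule.mem_top
    rw [Matrix.range_cons, Matrix.range_cons, Matrix.range_empty, Set.union_empty,
      Set.singleton_union, Submodule.mem_span_pair] at h2
    obtain ⟨c, d, hcd⟩ := h2
    have h3 : l = (Line.mk' o _ hDf).map (AffineEquiv.constVAdd F Ω (d • e)) := by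
      rw [h1, Line.map_constVAdd_mk', Line.mk'_eq_mk'_iff, vsub_vadd_eq_vsub_sub, ← hcd,
        add_sub_cancel_right]
      exact Submodule.smul_mem _ _ (Submodule.mem_span_singleton_self f)
    have h4 : op (W f) * Q (Line.mk' o _ hDf) = Q (Line.mk' o _ hDf) :=
      hW.2 _ hDf f (Submodule.mem_span_singleton_self f)
    rw [h3, ← hW.1, conj_eq, ← mul_assoc, ← mul_assoc, ← map_mul, (hcomm d).eq, map_mul,
      mul_assoc (op (W (d • e))), h4]
  have hWf : W f = 1 := by
    have := finite_line (F := F) (V := V) (Ω := Ω)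
    have := Fintype.ofFinite {l : Line F V Ω // l.1.direction = Submodule.span F {f}}
    have hsum := hQ.sum_parallel _ hDf
    rw [finsum_eq_sum_of_fintype] at hsum
    have h1 : op (W f) * (1 : End ℂ H) = 1 := by
      rw [End.one_eq_id, ← hsum, Finset.mul_sum]
      exact Finset.sum_congr rfl fun l _ => hl l.1 l.2
    rw [mul_one] at h1
    ext x
    exact LinearMap.congr_fun h1 x
  have h1 := hW.1 f (Line.mk' o _ hDe)
  rw [hWf, Line.map_constVAdd_mk'] at h1
  have h2 := hQ.eq_of_parallel (by
    change (AffineSubspace.mk' _ _).direction = (AffineSubspace.mk' _ _).direction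
    rw [AffineSubspace.direction_mk', AffineSubspace.direction_mk']) h1
  rw [eq_comm, Line.mk'_eq_mk'_iff, vadd_vsub] at h2
  obtain ⟨c, hc⟩ := Submodule.mem_span_singleton.1 h2
  have h4 := LinearIndependent.pair_iff.1 hli 1 (-c)
    (by rw [one_smul, neg_smul, hc, add_neg_cancel])
  exact one_ne_zero h4.1

/-- In characteristic two, involutions are transvections. -/
theorem exists_transvection_of_sq_eq_one [CharP F 2] {A : SpecialLinearGroup F V}
    (hA2 : A ^ 2 = 1) (hA1 : A ≠ 1) :
    ∃ e f : V, A.1 e = e ∧ A.1 f = f + e ∧ LinearIndependent F ![f, e] := by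
  obtain ⟨f, hf⟩ : ∃ f, A.1 f ≠ f := by
    by_contra! h
    exact hA1 (Subtype.ext (LinearEquiv.ext h))
  let e := A.1 f - f
  have he0 : e ≠ 0 := sub_ne_zero.2 hf
  have hAf : A.1 f = f + e := by simp [e]
  have hAA : A.1 (A.1 f) = f := by
    have := congrArg (fun B : SpecialLinearGroup F V => B.1 f) hA2
    rwa [pow_two] at this
  have hAe : A.1 e = e := by
    have h1 : A.1 e = -e := by simp [e, hAA]
    rw [h1, ← sub_eq_zero, ← neg_add', neg_eq_zero, ← two_smul F e, CharTwo.two_eq_zero, zero_smul]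
  have hf0 : f ≠ 0 := by
    rintro rfl
    exact hf (map_zero _)
  refine ⟨e, f, hAe, hAf, ?_⟩
  rw [LinearIndependent.pair_iff' hf0]
  intro c hc
  have h1 : A.1 (c • f) = c • f := by rw [hc, hAe]
  rw [map_smul, hAf, smul_add, add_eq_left] at h1
  rcases smul_eq_zero.1 h1 with h | h
  · rw [h, zero_smul] at hc
    exact he0 hc.symm
  · exact he0 h

/-- A group admitting a covariant quadrature system contains no involution. -/
theorem Admits.odd_card [Finite F] [CharP F 2] [FiniteDimensional F V] (hV : finrank F V = 2)
    {o : Ω} {G : Subgroup (SpecialLinearGroup F V)} (hG : Admits H o G) : Odd (Nat.card G) := by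
  have : Finite V := Module.finite_of_finite F
  have : Nontrivial V := nontrivial_of_finrank_pos (R := F) (by omega)
  have : Finite (V ≃ₗ[F] V) := DFunLike.finite _
  obtain ⟨Q, hQ, hcov⟩ := hG
  by_contra hodd
  rw [Nat.not_odd_iff_even, even_iff_two_dvd] at hodd
  have := Fact.mk Nat.prime_two
  obtain ⟨⟨A, hAG⟩, hA⟩ := exists_prime_orderOf_dvd_card' 2 hodd
  rw [Subgroup.orderOf_mk] at hA
  obtain ⟨e, f, he, hf, hli⟩ := exists_transvection_of_sq_eq_one (A := A)
    (by rw [← hA, pow_orderOf_eq_one]) (by rintro rfl; simp at hA)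
  obtain ⟨W, hadd, hline, hW, hP⟩ := hcov.exists_centered hQ
  obtain ⟨P, hP⟩ := hP A hAG
  exact hW.false_of_commute hV hQ hli (commute_of_transvection hadd hline hP he hf)

end Necessity

end PhaseSpace

end

theorem mainTheorem1
    {F : Type*} [Field F] [Finite F] [CharP F 2]
    {V : Type*} [AddCommGroup V] [Module F V] [FiniteDimensional F V]
    (hV : Module.finrank F V = 2)
    {Ω : Type*} [AddTorsor V Ω] (o : Ω)
    {H : Type*} [NormedAddCommGroup H] [InnerProductSpace ℂ H]
    (hH : Module.finrank ℂ H = Nat.card F)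
    (S : LinearMap.BilinForm F V) (hS : PhaseSpace.IsSymplecticForm S) :
    (∀ G₀ : Subgroup (SpecialLinearGroup F V),
      PhaseSpace.AdmitsWithForm H o S G₀ ↔ PhaseSpace.IsTorus G₀) ∧
    (∀ G₀ : Subgroup (SpecialLinearGroup F V),
      PhaseSpace.Admits H o G₀ ↔ PhaseSpace.IsTorus G₀) ∧
    (∀ G₀ : Subgroup (SpecialLinearGroup F V),
      Maximal (PhaseSpace.Admits H o) G₀ ↔
        (Nat.card F ≠ 2 ∧ Maximal PhaseSpace.IsSplitTorus G₀) ∨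
          Maximal PhaseSpace.IsNonsplitTorus G₀) ∧
    (∀ G₀ : Subgroup (SpecialLinearGroup F V),
      Maximal PhaseSpace.IsSplitTorus G₀ ↔
        PhaseSpace.IsSplitTorus G₀ ∧ Nat.card G₀ = Nat.card F - 1) ∧
    (∀ G₀ : Subgroup (SpecialLinearGroup F V),
      Maximal PhaseSpace.IsNonsplitTorus G₀ ↔
        PhaseSpace.IsNonsplitTorus G₀ ∧ Nat.card G₀ = Nat.card F + 1) := by
  have := Fintype.ofFinite F
  have hH' : Module.finrank ℂ H = Fintype.card F := by rw [hH, Nat.card_eq_fintype_card]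
  have h1 (G : Subgroup (SpecialLinearGroup F V)) :
      PhaseSpace.Admits H o G → PhaseSpace.IsTorus G := fun h =>
    PhaseSpace.isTorus_of_odd_card hV (h.odd_card hV)
  have h2 (G : Subgroup (SpecialLinearGroup F V)) :
      PhaseSpace.AdmitsWithForm H o S G → PhaseSpace.Admits H o G :=
    fun ⟨Q, hQ, hcov, _⟩ => ⟨Q, hQ, hcov⟩
  have h3 (G : Subgroup (SpecialLinearGroup F V)) :
      PhaseSpace.IsTorus G → PhaseSpace.AdmitsWithForm H o S G := fun h =>
    h.admitsWithForm hV hS hH' o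
  have h4 : PhaseSpace.Admits (F := F) (V := V) H o = PhaseSpace.IsTorus :=
    funext fun G => propext ⟨h1 G, fun h => h2 G (h3 G h)⟩
  refine ⟨fun G => ⟨fun h => h1 G (h2 G h), h3 G⟩, fun G => by rw [h4], fun G => ?_,
    PhaseSpace.maximal_isSplitTorus_iff hV, PhaseSpace.maximal_isNonsplitTorus_iff hV⟩
  rw [h4]
  exact PhaseSpace.maximal_isTorus_iff hV G
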